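/- Let $n\ge 1$. Let $F$ be a formally real Pythagorean field (so $-1$ is not a sum of squares in $F$, and every sum of squares in $F$ is a square), and let $\tilde F$ be an expansion of $F$ in a language $\mathcal L$ extending the language of unital rings $\{+,\cdot,-,0,1\}$. Suppose $\tilde F$ has quantifier elimination in $\mathcal L$. For an $\mathcal L$-structure $\tilde K$ that expands a field $K$, let $M_n(\tilde K)$ be the $\mathcal L$-structure that expands the matrix ring $M_n(K)$ as follows, where the center $C=K\cdot I_n$ of $M_n(K)$ is identified with $K$: a relation symbol of $\mathcal L$ that is not in the language of rings is interpreted as a relation on $C$, as given by $\tilde K$; a function symbol of arity $m\ge 0$ of $\mathcal L$ that is not in the language of rings is interpreted on $C^m$ as given by $\tilde K$, and takes the value $0$ outside $C^m$. Let $\mathcal L(\mathrm{tr},\mathrm{inv})$ be the extension of $\mathcal L$ by two new unary function symbols, and write $\mathcal M_n(\tilde K)=(M_n(\tilde K),\ X\mapsto \mathrm{tr}(X)I_n,\ X\mapsto X^t)$. Then the following are equivalent: 1. $\mathcal M_n(\tilde F)$ has quantifier elimination in $\mathcal L(\mathrm{tr},\mathrm{inv})$. 2. ($F$ has the Specht property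 for the transpose.) There is some $D\in\mathbb N$ (depending on $n$) such that for all $d$ and any two $d$-tuples $X=(X_1,\dots,X_d)$, $Y=(Y_1,\dots,Y_d)$ of matrices in $M_n(F)$ with $\mathrm{tr}(w(X,X^t))=\mathrm{tr}(w(Y,Y^t))$ for all words $w$ of length $\le D$ in the letters $x_1,\dots,x_d,x_1^t,\dots,x_d^t$, there is some $O\in M_n(F)$ with $OO^t=I_n$ and $O^tX_iO=Y_i$ for all $i$. 3. Whenever $\tilde K$ is an $\mathcal L$-structure elementarily equivalent to $\tilde F$, $\mathcal U$ is a substructure of $\mathcal M_n(\tilde K)$ and $\psi:\mathcal U\to\mathcal M_n(\tilde K)$ is an embedding, there are an elementary extension $\tilde\Omega\succ\tilde K$ and an embedding $\mathcal M_n(\tilde K)\to\mathcal M_n(\tilde\Omega)$ that extends $\psi$, where $\psi$ is composed with the inclusion $M_n(K)\subseteq M_n(\Omega)$. -/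

import Mathlib

open FirstOrder FirstOrder.Language FirstOrder.Ring
open scoped Matrix

universe u v w x

/-- A field is Pythagorean if every sum of squares is a square. -/
def IsPythagorean (F : Type u) [Field F] : Prop :=
  ∀ a : F, IsSumSq a → IsSquare a

/-- A structure has quantifier elimination if every formula is equivalent in it (equivalently:
modulo its complete theory) to a quantifier-free formula in the same variables. -/
def HasQE (L : FirstOrder.Language.{v, w}) (M : Type u) [L.Structure M] : Prop :=
  ∀ (k : ℕ) (φ : L.Formula (Fin k)), ∃ ψ : L.Formula (Fin k),
    BoundedFormula.IsQF ψ ∧ ∀ a : Fin k → M, φ.Realize a ↔ ψ.Realize a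

/-- Two unary function symbols, for the trace and for the transposition. -/
inductive TrInvFunc : ℕ → Type
  | tr : TrInvFunc 1
  | inv : TrInvFunc 1

/-- The language consisting of the two unary function symbols `tr` and `inv`. -/
def trInvLang : FirstOrder.Language.{0, 0} where
  Functions := TrInvFunc
  Relations := fun _ => Empty

/-- The language of unital rings together with the new symbols in `L`. -/
abbrev fieldLang (L : FirstOrder.Language.{v, w}) : FirstOrder.Language.{v, w} := Language.ring.sum L

/-- The extension of `fieldLang L` by the two unary function symbols `tr` and `inv`. -/
def matLang (L : FirstOrder.Language.{v, w}) : FirstOrder.Language.{v, w} := (fieldLang L).sum trInvLang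

/-- The interpretation in `M_n(K)` of the new symbols `L`, given their interpretation in `K`.
The center of `M_n(K)` is the set of scalar matrices; it is identified with `K` through
`a ↦ a • 1`. Relations hold only between central elements, where they are as given in `K`;
functions (in particular constants) are as given in `K` on central elements, and are `0` as soon
as one of the arguments is not central. -/
@[reducible]
noncomputable def newSymbolsStructure (L : FirstOrder.Language.{v, w}) (n : ℕ) (K : Type u) [Field K]
    [L.Structure K] : L.Structure (Matrix (Fin n) (Fin n) K) where
  funMap := fun {m} f X =>
    open Classical in
    if h : ∃ a : Fin m → K, ∀ i, X i = Matrix.scalar (Fin n) (a i) then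
      Matrix.scalar (Fin n) (Structure.funMap f h.choose)
    else 0
  RelMap := fun {m} r X =>
    ∃ a : Fin m → K, (∀ i, X i = Matrix.scalar (Fin n) (a i)) ∧ Structure.RelMap r a

/-- `tr` is the trace, as a scalar matrix, and `inv` is the transposition. -/
@[reducible]
def trInvStructure (n : ℕ) (K : Type u) [Field K] :
    trInvLang.Structure (Matrix (Fin n) (Fin n) K) where
  funMap := fun {_} f =>
    match f with
    | TrInvFunc.tr => fun X => Matrix.scalar (Fin n) (Matrix.trace (X 0))
    | TrInvFunc.inv => fun X => (X 0)ᵀ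
  RelMap := fun r _ => Empty.elim r

/-- The structure `(M_n(K), tr, transpose)` for the expansion of the field `K` given by an
interpretation of the new symbols `L`. -/
noncomputable instance matStructure (L : FirstOrder.Language.{v, w}) (n : ℕ) (K : Type u) [Field K]
    [L.Structure K] : (matLang L).Structure (Matrix (Fin n) (Fin n) K) :=
  @Language.sumStructure (fieldLang L) trInvLang _
    (@Language.sumStructure Language.ring L _
      (compatibleRingOfRing (Matrix (Fin n) (Fin n) K)).toStructure
      (newSymbolsStructure L n K))
    (trInvStructure n K)

/-- The value at `X` of a word in the letters `x_i` (coded `(i, false)`) and `x_i^t`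
(coded `(i, true)`). -/
def wordEval {F : Type u} [Field F] {n d : ℕ} (X : Fin d → Matrix (Fin n) (Fin n) F)
    (w : List (Fin d × Bool)) : Matrix (Fin n) (Fin n) F :=
  (w.map fun p => if p.2 then (X p.1)ᵀ else X p.1).prod

/-- The Specht property for the transpose, for matrices of size `n`. -/
def SpechtProperty (F : Type u) [Field F] (n : ℕ) : Prop :=
  ∃ D : ℕ, ∀ (d : ℕ) (X Y : Fin d → Matrix (Fin n) (Fin n) F),
    (∀ w : List (Fin d × Bool), w.length ≤ D →
      (wordEval X w).trace = (wordEval Y w).trace) →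
    ∃ O : Matrix (Fin n) (Fin n) F, O * Oᵀ = 1 ∧ ∀ i, Oᵀ * X i * O = Y i

/-- For every `K` elementarily equivalent to `F`, every embedding `ψ` of a substructure `U` of
`(M_n(K), tr, transpose)` into `(M_n(K), tr, transpose)` extends to an embedding of
`(M_n(K), tr, transpose)` into `(M_n(Ω), tr, transpose)` for some elementary extension `Ω` of `K`
(given as the target of an elementary embedding `j`, which `M_n(K) → M_n(Ω)` applies entrywise).
The universe of `K` is an arbitrary one above that of `F`; the universe of `Ω` leaves room for the
cardinality of the language. -/
def EmbeddingsExtend (L : FirstOrder.Language.{v, w}) (F : Type u) [Field F] [CompatibleRing F]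
    [L.Structure F] (n : ℕ) : Prop :=
  ∀ (K : Type (max u x)) [Field K] [CompatibleRing K] [L.Structure K],
    F ≅[fieldLang L] K →
    ∀ (U : (matLang L).Substructure (Matrix (Fin n) (Fin n) K))
      (ψ : U ↪[matLang L] Matrix (Fin n) (Fin n) K),
    ∃ (Ω : Type (max u v w x)) (_ : Field Ω) (_ : CompatibleRing Ω) (_ : L.Structure Ω)
      (j : K ↪ₑ[fieldLang L] Ω)
      (g : Matrix (Fin n) (Fin n) K ↪[matLang L] Matrix (Fin n) (Fin n) Ω),
      ∀ y : U, g (y : Matrix (Fin n) (Fin n) K) = (ψ y).map j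

/-!
Since `F` is formally real, `tr (AᵗA) = 0` only for `A = 0`. So the traces of words of bounded
length in `X` and `Xᵗ` determine which word polynomials vanish or are scalar, and thereby which
quantifier-free formulas from a given finite set `X` satisfies. Under the Specht property finitely
many traces determine `X` up to orthogonal conjugation, which is an automorphism of `M_n(F)`; so
they determine every formula that `X` satisfies. Traces are scalars, where quantifier elimination
of `F` applies: this gives quantifier elimination, and also the extension of embeddings after the
restriction of the embedding to scalars is realized by an elementary amalgam.

Conversely, the Specht property needs a conjugating matrix `O`. Let `(G i)ᵗ G j = δ i j G 0` with
`G 0 ≠ 0`, as for the matrix units `E i 0`, and let `u ≠ 0` be fixed by `G 0`. The vectors `G i u`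
are orthogonal and of the same square length `u ⬝ u`, which is a nonzero square because `F` is
Pythagorean; normalized, they are the columns of an orthogonal `O`, and `Y` equals `O X Oᵗ` as soon
as `Y` acts on the `G i` as `X` acts on the `E i 0`. That such `G i` exist is a formula in `Y` and
the entries of `X`, which quantifier elimination transfers from `X` itself to every `Y` with the
same traces. If embeddings extend, the `G i` are the images of the `E i 0` under an embedding that
extends `X ↦ Y`, where `(X, Y)` is a limit of counterexamples to the Specht property.
-/

/-! ### Quantifier-free formulas -/

section QuantifierFree

variable {L : FirstOrder.Language.{v, w}} {M N : Type*} [L.Structure M] [L.Structure N]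

theorem isQF_onBoundedFormula {L' : FirstOrder.Language} (g : L →ᴸ L') {α : Type*} {k : ℕ}
    {φ : L.BoundedFormula α k} (hφ : φ.IsQF) : (g.onBoundedFormula φ).IsQF := by
  induction hφ with
  | falsum => exact .falsum
  | of_isAtomic h =>
    cases h with
    | equal t₁ t₂ => exact (BoundedFormula.IsAtomic.equal _ _).isQF
    | rel r ts => exact (BoundedFormula.IsAtomic.rel _ _).isQF
  | imp _ _ ih₁ ih₂ => exact ih₁.imp ih₂

theorem isQF_subst {α β : Type*} {k : ℕ} {φ : L.BoundedFormula α k} (hφ : φ.IsQF)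
    (f : α → L.Term β) : (φ.subst f).IsQF := by
  induction hφ with
  | falsum => exact .falsum
  | of_isAtomic h =>
    cases h with
    | equal t₁ t₂ => exact (BoundedFormula.IsAtomic.equal _ _).isQF
    | rel r ts => exact (BoundedFormula.IsAtomic.rel _ _).isQF
  | imp _ _ ih₁ ih₂ => exact ih₁.imp ih₂

theorem realize_comp_embedding_iff (j : M ↪[L] N) {α : Type*} {φ : L.Formula α}
    (hφ : BoundedFormula.IsQF φ) (a : α → M) : φ.Realize (j ∘ a) ↔ φ.Realize a := by
  have realize_iff := hφ.realize_embedding j (v := a) (xs := default)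
  rwa [Subsingleton.elim (j ∘ default) default] at realize_iff

theorem HasQE.exists_isQF (h : HasQE L M) {α : Type*} (φ : L.Formula α) :
    ∃ ψ : L.Formula α, BoundedFormula.IsQF ψ ∧ ∀ a : α → M, φ.Realize a ↔ ψ.Realize a := by
  classical
  obtain ⟨k, ⟨e⟩⟩ := Finite.exists_equiv_fin φ.freeVarFinset
  obtain ⟨ψ, hψ, hφψ⟩ := h k (φ.restrictFreeVar e)
  refine ⟨ψ.relabel fun i => (e.symm i : α), hψ.relabel _, fun a => ?_⟩
  rw [Formula.realize_relabel, ← hφψ]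
  exact (BoundedFormula.realize_restrictFreeVar a (by simp)).symm

theorem forall_realize_iff_of_elementarilyEquivalent (hMN : M ≅[L] N) {α : Type*} [Finite α]
    (φ : L.Formula α) : (∀ a : α → M, φ.Realize a) ↔ ∀ a : α → N, φ.Realize a := by
  simpa [Sentence.Realize, Formula.realize_iAlls, Formula.realize_relabel] using
    elementarilyEquivalent_iff.1 hMN (Formula.iAlls α (φ.relabel Sum.inr))

theorem HasQE.of_elementarilyEquivalent (hMN : M ≅[L] N) (h : HasQE L M) : HasQE L N := by
  intro k φ
  obtain ⟨ψ, hψ, hφψ⟩ := h k φ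
  simp only [← Formula.realize_iff] at hφψ ⊢
  exact ⟨ψ, hψ, (forall_realize_iff_of_elementarilyEquivalent hMN _).1 hφψ⟩

theorem exists_embedding_of_realize_isQF_iff {ι : Type*} {a : ι → M} {b : ι → N}
    (h : ∀ φ : L.Formula ι, BoundedFormula.IsQF φ → (φ.Realize a ↔ φ.Realize b)) :
    ∃ (U : L.Substructure M) (ψ : U ↪[L] N), ∀ i, ∃ hi : a i ∈ U, ψ ⟨a i, hi⟩ = b i := by
  let U : L.Substructure M :=
    { carrier := Set.range fun t : L.Term ι => t.realize a
      fun_mem := fun f x hx => by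
        choose t ht using hx
        exact ⟨Term.func f t, congrArg _ (funext ht)⟩ }
  choose t ht using fun x : U => x.2
  have realize_eq_iff (t₁ t₂ : L.Term ι) :
      t₁.realize a = t₂.realize a ↔ t₁.realize b = t₂.realize b := by
    simpa only [Formula.realize_equal] using
      h (t₁.equal t₂) (BoundedFormula.IsAtomic.equal _ _).isQF
  have realize_t {x : U} {s : L.Term ι} (hs : s.realize a = x) :
      (t x).realize b = s.realize b :=
    (realize_eq_iff _ _).1 ((ht x).trans hs.symm)
  refine ⟨U, ⟨⟨fun x => (t x).realize b, fun x y hxy => ?_⟩, fun {k} f x => ?_, fun {k} r x => ?_⟩,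
    fun i => ⟨⟨Term.var i, rfl⟩, realize_t (s := Term.var i) rfl⟩⟩
  · exact Subtype.ext ((ht x).symm.trans (((realize_eq_iff _ _).2 hxy).trans (ht y)))
  · exact realize_t (s := Term.func f fun i => t (x i)) (congrArg _ (funext fun i => ht (x i)))
  · have hr := h (r.formula fun i => t (x i)) (BoundedFormula.IsAtomic.rel _ _).isQF
    rw [Formula.realize_rel, Formula.realize_rel, funext fun i => ht (x i)] at hr
    exact hr.symm

end QuantifierFree

/-! ### Elementary extensions -/

section ElementaryExtensions

variable {L : FirstOrder.Language.{v, w}}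

/-- In the elementary extension `j : M ↪ₑ[L] N` the tuple `b` is a limit of the tuples `a i` along
the filter `l`: whatever eventually holds of `a i` and parameters from `M` holds of `b`. -/
def IsElementaryLimit {M N I α : Type*} [L.Structure M] [L.Structure N] (l : Filter I)
    (a : I → α → M) (j : M ↪ₑ[L] N) (b : α → N) : Prop :=
  ∀ φ : L.Formula (α ⊕ M), (∀ᶠ i in l, φ.Realize (Sum.elim (a i) id)) → φ.Realize (Sum.elim b j)

theorem IsElementaryLimit.realize {M N I α : Type*} [L.Structure M] [L.Structure N] {l : Filter I}
    {a : I → α → M} {j : M ↪ₑ[L] N} {b : α → N} (h : IsElementaryLimit l a j b) {φ : L.Formula α}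
    (hφ : ∀ᶠ i in l, φ.Realize (a i)) : φ.Realize b :=
  (Formula.realize_relabel (g := Sum.inl) (v := Sum.elim b j)).1 <| h _ <|
    hφ.mono fun _ hi => Formula.realize_relabel.2 hi

theorem exists_isElementaryLimit {M : Type u} [L.Structure M] [Nonempty M] {α : Type*}
    {I : Type x} (l : Filter I) [l.NeBot] (a : I → α → M) :
    ∃ (N : Type (max u x)) (_ : L.Structure N) (j : M ↪ₑ[L] N) (b : α → N),
      IsElementaryLimit l a j b := by
  let U := Ultrafilter.of l
  let mk : (I → M) → (U : Filter I).Product fun _ => M := fun a => a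
  refine ⟨(U : Filter I).Product fun _ => M, inferInstance, ⟨fun c => mk fun _ => c, ?_⟩,
    fun p => mk fun i => a i p, fun φ hφ => ?_⟩
  · intro k φ c
    exact (Ultraproduct.realize_formula_cast φ fun q _ => c q).trans (Filter.eventually_const)
  · have h := (Ultraproduct.realize_formula_cast φ
      fun q i => Sum.elim (a i) id q).2 (hφ.filter_mono (Ultrafilter.of_le l))
    exact cast (congrArg φ.Realize (by funext q; cases q <;> rfl)) h

theorem exists_extension_realize {M N ι : Type*} [L.Structure M] [L.Structure N] [Nonempty N]
    {a : ι → M} {b : ι → N} (hab : ∀ φ : L.Formula ι, φ.Realize a → φ.Realize b)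
    {φ : L.Formula M} (hφ : φ.Realize id) :
    ∃ f : M → N, (∀ i, f (a i) = b i) ∧ φ.Realize f := by
  classical
  let isParam (c : M) : Prop := ∃ i, a i = c
  let ψ : L.Formula (ι ⊕ φ.freeVarFinset) := φ.restrictFreeVar fun c =>
    if h : isParam c then Sum.inl h.choose else Sum.inr c
  have hψa : (ψ.iExs φ.freeVarFinset).Realize a := by
    refine (Formula.realize_iExs ..).2
      ⟨Subtype.val, (BoundedFormula.realize_restrictFreeVar id fun c => ?_).2 hφ⟩
    by_cases h : isParam c
    · simpa [h] using h.choose_spec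
    · simp [h]
  obtain ⟨g, hg⟩ := (Formula.realize_iExs ..).1 (hab _ hψa)
  have b_eq_b (i i' : ι) (h : a i = a i') : b i = b i' := by
    simpa [Formula.realize_equal, h] using hab ((Term.var i).equal (Term.var i'))
  let f (c : M) : N := if h : isParam c then b h.choose else
    if hc : c ∈ φ.freeVarFinset then g ⟨c, hc⟩ else Classical.arbitrary N
  refine ⟨f, fun i => ?_, (BoundedFormula.realize_restrictFreeVar f fun c => ?_).1 hg⟩
  · have h : isParam (a i) := ⟨i, rfl⟩
    simpa [f, h] using b_eq_b _ _ h.choose_spec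
  · by_cases h : isParam c <;> simp [f, h]

theorem exists_elementary_amalgam {M : Type u} {N : Type x} {ι : Type*} [L.Structure M]
    [L.Structure N] [Nonempty N] {a : ι → M} {b : ι → N}
    (hab : ∀ φ : L.Formula ι, φ.Realize a → φ.Realize b) :
    ∃ (Ω : Type (max u v w x)) (_ : L.Structure Ω) (σ : M ↪ₑ[L] Ω) (j : N ↪ₑ[L] Ω),
      ∀ i, σ (a i) = j (b i) := by
  classical
  have exists_map (S : Finset (L.Formula M)) : ∃ f : M → N, (∀ i, f (a i) = b i) ∧
      ∀ φ ∈ S, φ.Realize id → φ.Realize f := by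
    obtain ⟨f, hfa, hf⟩ := exists_extension_realize hab
      (φ := Formula.iInf fun φ : {φ : S // φ.1.Realize id} => φ.1.1)
      (Formula.realize_iInf.2 fun φ => φ.2)
    exact ⟨f, hfa, fun φ hφ hr => Formula.realize_iInf.1 hf ⟨⟨φ, hφ⟩, hr⟩⟩
  choose f hfa hf using exists_map
  obtain ⟨Ω, _, j, σ, hσ⟩ := exists_isElementaryLimit (L := L) (Filter.atTop) f
  have realize_σ (φ : L.Formula M) (hφ : φ.Realize id) : φ.Realize σ :=
    hσ.realize <| (Filter.eventually_ge_atTop {φ}).mono fun S hS =>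
      hf S φ (Finset.singleton_subset_iff.1 hS) hφ
  have realize_σ_iff (φ : L.Formula M) : φ.Realize σ ↔ φ.Realize id :=
    ⟨fun h => by_contra fun hn => realize_σ φ.not hn h, realize_σ φ⟩
  refine ⟨Ω, _, ⟨σ, fun k φ c => ?_⟩, j, fun i => ?_⟩
  · simpa [Formula.realize_relabel] using realize_σ_iff (φ.relabel c)
  · change σ (a i) = j (b i)
    simpa [Formula.realize_equal] using
      hσ ((Term.var (Sum.inl (a i))).equal (Term.var (Sum.inr (b i))))
        (.of_forall fun S => by simp [Formula.realize_equal, hfa])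

end ElementaryExtensions

/-! ### Interpretations in tuples -/

/-- An interpretation of `L₁`-structures in `L₂`-structures whose elements are the `ι`-tuples of
elements of the `L₂`-structure. The variable `(a, i)` of a formula stands for the `i`-th coordinate
of the element `a`; a function symbol is interpreted by its graph, with value `Sum.inr ()`. -/
structure TupleInterpretation (L₁ L₂ : FirstOrder.Language) (ι : Type*) where
  funGraph {k : ℕ} : L₁.Functions k → L₂.Formula ((Fin k ⊕ Unit) × ι)
  rel {k : ℕ} : L₁.Relations k → L₂.Formula (Fin k × ι)

namespace TupleInterpretation

variable {L₁ L₂ : FirstOrder.Language} {ι M M' N N' α β γ : Type*}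
  [L₂.Structure M] [L₂.Structure M'] [L₁.Structure N] [L₁.Structure N']

/-- The coordinates of a family of elements of `N`, as an assignment of the variables that a
`TupleInterpretation` uses. -/
def coords (e : N ≃ (ι → M)) (X : β → N) : β × ι → M := fun p => e (X p.1) p.2

theorem coords_comp_map (e : N ≃ (ι → M)) (X : β → N) (g : α → β) :
    coords e X ∘ Prod.map g id = coords e (X ∘ g) :=
  rfl

theorem exists_coords_eq (e : N ≃ (ι → M)) (c : β × ι → M) : ∃ X : β → N, coords e X = c :=
  ⟨fun b => e.symm fun i => c (b, i), by ext p; simp [coords]⟩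

/-- Rename the elements, but not the coordinates. -/
def rename (g : α → β) (φ : L₂.Formula (α × ι)) : L₂.Formula (β × ι) :=
  φ.relabel (Prod.map g id)

@[simp] theorem realize_rename (e : N ≃ (ι → M)) (g : α → β) (φ : L₂.Formula (α × ι))
    (X : β → N) : (rename g φ).Realize (coords e X) ↔ φ.Realize (coords e (X ∘ g)) := by
  rw [rename, Formula.realize_relabel, coords_comp_map]

variable [Finite ι]

/-- Existential quantification over all the coordinates of a finite family of elements. -/
noncomputable def exTuples [Finite γ] (φ : L₂.Formula ((β ⊕ γ) × ι)) : L₂.Formula (β × ι) :=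
  (φ.relabel (Equiv.sumProdDistrib β γ ι)).iExs (γ × ι)

@[simp] theorem realize_exTuples [Finite γ] (e : N ≃ (ι → M)) (φ : L₂.Formula ((β ⊕ γ) × ι))
    (X : β → N) :
    (exTuples φ).Realize (coords e X) ↔ ∃ Y : γ → N, φ.Realize (coords e (Sum.elim X Y)) := by
  have coords_elim (Y : γ → N) :
      Sum.elim (coords e X) (coords e Y) ∘ Equiv.sumProdDistrib β γ ι =
        coords e (Sum.elim X Y) := by
    ext ⟨b | c, i⟩ <;> rfl
  simp only [exTuples, Formula.realize_iExs, ← coords_elim, Formula.realize_relabel]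
  refine ⟨fun ⟨c, hc⟩ => ?_, fun ⟨Y, hY⟩ => ⟨coords e Y, hY⟩⟩
  obtain ⟨Y, rfl⟩ := exists_coords_eq e c
  exact ⟨Y, hc⟩

variable (I : TupleInterpretation L₁ L₂ ι)

/-- The formula defining the graph of a term. -/
noncomputable def termGraph : L₁.Term β → L₂.Formula ((β ⊕ Unit) × ι)
  | .var b => Formula.iInf fun i =>
      (Term.var (Sum.inr (), i)).equal (Term.var (Sum.inl b, i))
  | .func (l := k) f ts => exTuples (γ := Fin k) <|
      (Formula.iInf fun q =>
        rename (Sum.elim (Sum.inl ∘ Sum.inl) fun _ => Sum.inr q) (termGraph (ts q))) ⊓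
      rename (Sum.elim Sum.inr fun _ => Sum.inl (Sum.inr ())) (I.funGraph f)

/-- The translation of a formula about elements into a formula about their coordinates. -/
noncomputable def translate : {m : ℕ} → L₁.BoundedFormula α m → L₂.Formula ((α ⊕ Fin m) × ι)
  | _, .falsum => ⊥
  | _, .equal t₁ t₂ => exTuples (γ := Unit) (I.termGraph t₁ ⊓ I.termGraph t₂)
  | _, .rel (l := k) r ts => exTuples (γ := Fin k) <|
      (Formula.iInf fun q => rename (Sum.map id fun _ => q) (I.termGraph (ts q))) ⊓
      rename Sum.inr (I.rel r)
  | _, .imp φ ψ => (translate φ).imp (translate ψ)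
  | _, .all φ => Formula.not <| exTuples (γ := Unit) <| Formula.not <|
      rename (Sum.elim (Sum.inl ∘ Sum.inl)
        (Fin.lastCases (Sum.inr ()) fun q => Sum.inl (Sum.inr q))) (translate φ)

/-- The translation of a formula without bound variables in its context. -/
noncomputable def translateFormula (φ : L₁.Formula α) : L₂.Formula (α × ι) :=
  rename (Sum.elim id Fin.elim0) (I.translate φ)

/-- The bijection `e` between `N` and the `ι`-tuples in `M` makes `N` the structure interpreted
in `M` by `I`. -/
structure Holds (e : N ≃ (ι → M)) : Prop where
  realize_funGraph {k : ℕ} (f : L₁.Functions k) (X : Fin k → N) (Y : Unit → N) :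
    (I.funGraph f).Realize (coords e (Sum.elim X Y)) ↔ Y () = Structure.funMap f X
  realize_rel {k : ℕ} (r : L₁.Relations k) (X : Fin k → N) :
    (I.rel r).Realize (coords e X) ↔ Structure.RelMap r X

namespace Holds

variable {I} {e : N ≃ (ι → M)} {e' : N' ≃ (ι → M')}

theorem realize_termGraph (hI : I.Holds e) (t : L₁.Term β) (X : β → N) (Y : Unit → N) :
    (I.termGraph t).Realize (coords e (Sum.elim X Y)) ↔ Y () = t.realize X := by
  induction t generalizing Y with
  | var b =>
    simp only [termGraph, Formula.realize_iInf, Formula.realize_equal, Term.realize_var]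
    exact funext_iff.symm.trans e.injective.eq_iff
  | @func k f ts ih =>
    have hts (Z : Fin k → N) (q : Fin k) :
        (rename (Sum.elim (Sum.inl ∘ Sum.inl) fun _ => Sum.inr q) (I.termGraph (ts q))).Realize
          (coords e (Sum.elim (Sum.elim X Y) Z)) ↔ Z q = (ts q).realize X := by
      rw [realize_rename, Sum.comp_elim]
      exact ih q fun _ => Z q
    have hf (Z : Fin k → N) :
        (rename (Sum.elim Sum.inr fun _ => Sum.inl (Sum.inr ())) (I.funGraph f)).Realize
          (coords e (Sum.elim (Sum.elim X Y) Z)) ↔ Y () = Structure.funMap f Z := by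
      rw [realize_rename, Sum.comp_elim]
      exact hI.realize_funGraph f Z Y
    simp only [termGraph, realize_exTuples, Formula.realize_inf, Formula.realize_iInf, hts, hf,
      ← funext_iff, exists_eq_left, Term.realize_func]

theorem realize_translate {m : ℕ} (hI : I.Holds e) (φ : L₁.BoundedFormula α m) (X : α → N)
    (xs : Fin m → N) :
    (I.translate φ).Realize (coords e (Sum.elim X xs)) ↔ φ.Realize X xs := by
  induction φ with
  | falsum => rfl
  | equal t₁ t₂ =>
    simp only [translate, realize_exTuples, Formula.realize_inf, hI.realize_termGraph]
    exact ⟨fun ⟨Y, h₁, h₂⟩ => h₁.symm.trans h₂, fun h => ⟨fun _ => t₁.realize _, rfl, h⟩⟩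
  | @rel m k r ts =>
    have hts (Z : Fin k → N) (q : Fin k) :
        (rename (Sum.map id fun _ => q) (I.termGraph (ts q))).Realize
          (coords e (Sum.elim (Sum.elim X xs) Z)) ↔
          Z q = (ts q).realize (Sum.elim X xs) := by
      rw [realize_rename, Sum.elim_comp_map]
      exact hI.realize_termGraph _ _ fun _ => Z q
    simp only [translate, realize_exTuples, Formula.realize_inf, Formula.realize_iInf, hts,
      ← funext_iff, exists_eq_left, realize_rename, Sum.elim_comp_inr, hI.realize_rel]
    rfl
  | imp φ ψ ihφ ihψ =>
    simp only [translate, Formula.realize_imp, ihφ, ihψ, BoundedFormula.realize_imp]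
  | @all m φ ih =>
    have elim_comp (Y : Unit → N) :
        Sum.elim (Sum.elim X xs) Y ∘ Sum.elim (Sum.inl ∘ Sum.inl)
          (Fin.lastCases (Sum.inr ()) fun q => Sum.inl (Sum.inr q)) =
        Sum.elim X (Fin.snoc xs (Y ())) := by
      rw [Sum.comp_elim]
      refine congrArg (Sum.elim X) (funext fun q => ?_)
      cases q using Fin.lastCases <;> simp
    simp only [translate, Formula.realize_not, realize_exTuples, realize_rename, elim_comp, ih,
      not_exists, not_not, BoundedFormula.realize_all]
    exact ⟨fun h y => h fun _ => y, fun h Y => h (Y ())⟩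

theorem realize_translateFormula (hI : I.Holds e) (φ : L₁.Formula α) (X : α → N) :
    (I.translateFormula φ).Realize (coords e X) ↔ φ.Realize X := by
  rw [translateFormula, realize_rename, Sum.comp_elim, Subsingleton.elim (X ∘ Fin.elim0) default]
  exact hI.realize_translate φ X default

theorem elementarilyEquivalent (hI : I.Holds e) (hI' : I.Holds e') (h : M ≅[L₂] M') :
    N ≅[L₁] N' := by
  refine elementarilyEquivalent_iff.2 fun φ => ?_
  rw [Sentence.Realize, Sentence.Realize, ← hI.realize_translateFormula,
    ← hI'.realize_translateFormula]
  simpa only [Unique.forall_iff, Unique.eq_default] using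
    forall_realize_iff_of_elementarilyEquivalent h (I.translateFormula φ)

/-- The coordinatewise extension of an elementary embedding. -/
def elementaryEmbedding (hI : I.Holds e) (hI' : I.Holds e') (j : M ↪ₑ[L₂] M') :
    N ↪ₑ[L₁] N' where
  toFun X := e'.symm (j ∘ e X)
  map_formula' k φ X := by
    rw [← hI.realize_translateFormula, ← hI'.realize_translateFormula, ← j.map_formula]
    refine iff_of_eq (congrArg _ ?_)
    ext p
    simp [coords]

theorem apply_elementaryEmbedding (hI : I.Holds e) (hI' : I.Holds e') (j : M ↪ₑ[L₂] M') (X : N) :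
    e' (hI.elementaryEmbedding hI' j X) = j ∘ e X :=
  e'.apply_symm_apply _

theorem isElementaryLimit (hI : I.Holds e) (hI' : I.Holds e') {j : M ↪ₑ[L₂] M'} {J : Type*}
    {l : Filter J} {X : J → α → N} {Y : α → N'}
    (h : IsElementaryLimit l (fun q => coords e (X q)) j (coords e' Y)) :
    IsElementaryLimit l X (hI.elementaryEmbedding hI' j) Y := by
  let split : (α ⊕ N) × ι → (α × ι) ⊕ M := fun p =>
    p.1.elim (fun a => Sum.inl (a, p.2)) fun y => Sum.inr (e y p.2)
  have elim_comp_split (q : J) :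
      Sum.elim (coords e (X q)) id ∘ split = coords e (Sum.elim (X q) id) := by
    ext ⟨a | y, i⟩ <;> rfl
  have elim_comp_split' : Sum.elim (coords e' Y) j ∘ split =
      coords e' (Sum.elim Y (hI.elementaryEmbedding hI' j)) := by
    ext ⟨a | y, i⟩
    · rfl
    · exact (congrFun (hI.apply_elementaryEmbedding hI' j y) i).symm
  intro φ hφ
  have := h ((I.translateFormula φ).relabel split)
  simp only [Formula.realize_relabel, elim_comp_split, elim_comp_split',
    hI.realize_translateFormula, hI'.realize_translateFormula] at this
  exact this hφ

end Holds
end TupleInterpretation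

/-! ### Formally real fields and orthogonal matrices -/

section Semireal

variable {K m k : Type*} [Field K] [IsSemireal K] [Fintype m] [Fintype k]

theorem eq_zero_of_mul_self_add_eq_zero {x s : K} (hs : IsSumSq s) (h : x * x + s = 0) :
    x = 0 := by
  by_contra hx
  refine IsSemireal.one_add_ne_zero ((IsSumSq.mul_self x⁻¹).mul hs) ?_
  field_simp
  linear_combination h

theorem eq_zero_of_dotProduct_self {v : m → K} (h : v ⬝ᵥ v = 0) : v = 0 := by
  classical
  ext i
  rw [dotProduct, ← Finset.add_sum_erase _ _ (Finset.mem_univ i)] at h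
  exact eq_zero_of_mul_self_add_eq_zero (.sum_mul_self _ _) h

theorem eq_zero_of_trace_transpose_mul {A : Matrix m k K} (h : (Aᵀ * A).trace = 0) : A = 0 := by
  rw [← Matrix.vec_dotProduct_vec] at h
  exact Matrix.vec_eq_zero_iff.1 (eq_zero_of_dotProduct_self h)

end Semireal

section Orthogonal

variable {K m ι κ : Type*} [Field K] [Fintype m]

/-- The matrix with the columns `G i *ᵥ u`. -/
def frame (G : m → Matrix m m K) (u : m → K) : Matrix m m K :=
  Matrix.of fun a i => (G i *ᵥ u) a

theorem mul_frame {G : m → Matrix m m K} {X Y : Matrix m m K}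
    (h : ∀ i, Y * G i = ∑ j, X j i • G j) (u : m → K) : Y * frame G u = frame G u * X := by
  ext a i
  have mul_apply : (Y * frame G u) a i = (Y *ᵥ (G i *ᵥ u)) a := rfl
  rw [mul_apply, Matrix.mulVec_mulVec, h, Matrix.sum_mulVec, Finset.sum_apply, Matrix.mul_apply]
  simp [frame, Matrix.smul_mulVec, mul_comm]

variable [DecidableEq m]

/-- The family `Y` is the conjugate of the family `X` by an orthogonal matrix. -/
def OrthogonallyConjugate (X Y : ι → Matrix m m K) : Prop :=
  ∃ O : Matrix m m K, O * Oᵀ = 1 ∧ ∀ i, Oᵀ * X i * O = Y i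

theorem OrthogonallyConjugate.symm {X Y : ι → Matrix m m K} (h : OrthogonallyConjugate X Y) :
    OrthogonallyConjugate Y X := by
  obtain ⟨O, hO, hXY⟩ := h
  refine ⟨Oᵀ, by rw [Matrix.transpose_transpose, mul_eq_one_comm.1 hO], fun i => ?_⟩
  calc Oᵀᵀ * Y i * Oᵀ = O * Oᵀ * X i * (O * Oᵀ) := by
        rw [← hXY, Matrix.transpose_transpose]; simp only [Matrix.mul_assoc]
    _ = X i := by rw [hO, one_mul, mul_one]

theorem OrthogonallyConjugate.of_mem_span {X Y : ι → Matrix m m K} {X' Y' : κ → Matrix m m K}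
    (h : OrthogonallyConjugate X Y)
    (hspan : ∀ k, (X' k, Y' k) ∈ Submodule.span K (Set.range fun i => (X i, Y i))) :
    OrthogonallyConjugate X' Y' := by
  obtain ⟨O, hO, hXY⟩ := h
  have conj_eq {p : Matrix m m K × Matrix m m K}
      (hp : p ∈ Submodule.span K (Set.range fun i => (X i, Y i))) : Oᵀ * p.1 * O = p.2 := by
    induction hp using Submodule.span_induction with
    | mem p hp => obtain ⟨i, rfl⟩ := hp; exact hXY i
    | zero => simp
    | add p q _ _ hp hq => simp [mul_add, add_mul, hp, hq]
    | smul a p _ hp => simp [hp]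
  exact ⟨O, hO, fun k => conj_eq (hspan k)⟩

/-- The matrices `G i` multiply like the matrix units `E i i₀` of one column. -/
structure IsUnitColumn (i₀ : m) (G : m → Matrix m m K) : Prop where
  transpose_mul (i j : m) : (G i)ᵀ * G j = if i = j then G i₀ else 0
  ne_zero : G i₀ ≠ 0

theorem isUnitColumn_single (i₀ : m) :
    IsUnitColumn i₀ fun i => Matrix.single i i₀ (1 : K) where
  transpose_mul i j := by
    rw [Matrix.transpose_single]
    split_ifs with h
    · subst h; simp
    · simp [h]
  ne_zero h := by simpa using congrFun (congrFun h i₀) i₀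

theorem mul_single_column (i₀ i : m) (X : Matrix m m K) :
    X * Matrix.single i i₀ 1 = ∑ j, X j i • Matrix.single j i₀ (1 : K) := by
  ext a b
  rw [Matrix.sum_apply]
  simp [Matrix.mul_apply, Matrix.single_apply, ite_and]

namespace IsUnitColumn

variable {i₀ : m} {G : m → Matrix m m K}

theorem isIdempotentElem (hG : IsUnitColumn i₀ G) : IsIdempotentElem (G i₀) := by
  have h : (G i₀)ᵀ * G i₀ = G i₀ := by simpa using hG.transpose_mul i₀ i₀
  have symmetric : (G i₀)ᵀ = G i₀ := by
    rw [← h, Matrix.transpose_mul, Matrix.transpose_transpose]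
  rwa [symmetric] at h

theorem exists_mulVec_eq_self (hG : IsUnitColumn i₀ G) : ∃ u, u ≠ 0 ∧ G i₀ *ᵥ u = u := by
  obtain ⟨v, hv⟩ : ∃ v, G i₀ *ᵥ v ≠ 0 := by
    by_contra! h
    exact hG.ne_zero (Matrix.ext_of_mulVec_single fun i => by rw [h, Matrix.zero_mulVec])
  exact ⟨G i₀ *ᵥ v, hv, by rw [Matrix.mulVec_mulVec, hG.isIdempotentElem]⟩

theorem transpose_frame_mul_frame (hG : IsUnitColumn i₀ G) {u : m → K} (hu : G i₀ *ᵥ u = u) :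
    (frame G u)ᵀ * frame G u = (u ⬝ᵥ u) • (1 : Matrix m m K) := by
  ext i j
  have mul_apply : ((frame G u)ᵀ * frame G u) i j = (G i *ᵥ u) ⬝ᵥ (G j *ᵥ u) := rfl
  rw [mul_apply, ← Matrix.vecMul_transpose, ← Matrix.dotProduct_mulVec, Matrix.mulVec_mulVec,
    hG.transpose_mul]
  by_cases hij : i = j <;> simp [hij, hu]

theorem exists_orthogonal [IsSemireal K] (hK : IsPythagorean K) (hG : IsUnitColumn i₀ G) :
    ∃ O : Matrix m m K, O * Oᵀ = 1 ∧
      ∀ X Y : Matrix m m K, (∀ i, Y * G i = ∑ j, X j i • G j) → Oᵀ * Y * O = X := by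
  obtain ⟨u, hu0, hu⟩ := hG.exists_mulVec_eq_self
  obtain ⟨c, hc⟩ : IsSquare (u ⬝ᵥ u) := hK _ (.sum_mul_self _ _)
  have hc0 : c ≠ 0 := fun h => hu0 (eq_zero_of_dotProduct_self (by rw [hc, h, zero_mul]))
  let O := c⁻¹ • frame G u
  have hO : Oᵀ * O = 1 := by
    simp only [O, Matrix.transpose_smul, Matrix.smul_mul, Matrix.mul_smul,
      hG.transpose_frame_mul_frame hu, hc, smul_smul]
    rw [show c⁻¹ * (c⁻¹ * (c * c)) = 1 by field_simp, one_smul]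
  refine ⟨O, mul_eq_one_comm.1 hO, fun X Y h => ?_⟩
  have mul_O : Y * O = O * X := by
    simp only [O, Matrix.mul_smul, Matrix.smul_mul, mul_frame h]
  rw [Matrix.mul_assoc, mul_O, ← Matrix.mul_assoc, hO, one_mul]

end IsUnitColumn

end Orthogonal

/-! ### Traces of words -/

section Words

variable {K : Type*} [Field K] {n d : ℕ}

@[simp] theorem wordEval_nil (X : Fin d → Matrix (Fin n) (Fin n) K) : wordEval X [] = 1 := rfl

theorem wordEval_cons (X : Fin d → Matrix (Fin n) (Fin n) K) (p : Fin d × Bool)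
    (w : List (Fin d × Bool)) :
    wordEval X (p :: w) = (if p.2 then (X p.1)ᵀ else X p.1) * wordEval X w := by
  simp [wordEval]

theorem wordEval_append (X : Fin d → Matrix (Fin n) (Fin n) K) (v w : List (Fin d × Bool)) :
    wordEval X (v ++ w) = wordEval X v * wordEval X w := by
  simp [wordEval]

/-- The word whose value is the transpose of the value of `w`. -/
def transposeWord (w : List (Fin d × Bool)) : List (Fin d × Bool) :=
  (w.map fun p => (p.1, !p.2)).reverse

@[simp] theorem length_transposeWord (w : List (Fin d × Bool)) :
    (transposeWord w).length = w.length := by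
  simp [transposeWord]

theorem wordEval_transposeWord (X : Fin d → Matrix (Fin n) (Fin n) K) (w : List (Fin d × Bool)) :
    wordEval X (transposeWord w) = (wordEval X w)ᵀ := by
  induction w with
  | nil => simp [transposeWord]
  | cons p w ih =>
    have transposeWord_cons : transposeWord (p :: w) = transposeWord w ++ [(p.1, !p.2)] := by
      simp [transposeWord]
    rw [transposeWord_cons, wordEval_append, wordEval_cons, ih, wordEval_cons,
      Matrix.transpose_mul]
    rcases p with ⟨i, _ | _⟩ <;> simp

/-- The span of the pairs of values at `X` and at `Y` of the words of length at most `m`. -/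
def wordSpan (X Y : Fin d → Matrix (Fin n) (Fin n) K) (m : ℕ) :
    Submodule K (Matrix (Fin n) (Fin n) K × Matrix (Fin n) (Fin n) K) :=
  Submodule.span K ((fun w => (wordEval X w, wordEval Y w)) '' {w | w.length ≤ m})

variable {X Y : Fin d → Matrix (Fin n) (Fin n) K} {m m' : ℕ}
  {p q : Matrix (Fin n) (Fin n) K × Matrix (Fin n) (Fin n) K}

theorem wordSpan_mono (h : m ≤ m') : wordSpan X Y m ≤ wordSpan X Y m' :=
  Submodule.span_mono (Set.image_mono fun _ hw => le_trans hw h)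

theorem wordEval_mem_wordSpan {w : List (Fin d × Bool)} (hw : w.length ≤ m) :
    (wordEval X w, wordEval Y w) ∈ wordSpan X Y m :=
  Submodule.subset_span ⟨w, hw, rfl⟩

theorem letter_mem_wordSpan (i : Fin d) (hm : 1 ≤ m) : (X i, Y i) ∈ wordSpan X Y m := by
  simpa [wordEval] using
    wordEval_mem_wordSpan (X := X) (Y := Y) (w := [(i, false)]) (by simpa using hm)

theorem scalar_mem_wordSpan (a : K) :
    (Matrix.scalar (Fin n) a, Matrix.scalar (Fin n) a) ∈ wordSpan X Y m := by
  have := (wordSpan X Y m).smul_mem a (wordEval_mem_wordSpan (w := []) (Nat.zero_le _))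
  simpa [Prod.smul_mk, Matrix.smul_one_eq_diagonal] using this

theorem mul_mem_wordSpan (hp : p ∈ wordSpan X Y m) (hq : q ∈ wordSpan X Y m') :
    p * q ∈ wordSpan X Y (m + m') := by
  have h := Submodule.mul_mem_mul hp hq
  rw [wordSpan, wordSpan, Submodule.span_mul_span] at h
  refine Submodule.span_mono ?_ h
  rintro _ ⟨_, ⟨v, hv, rfl⟩, _, ⟨w, hw, rfl⟩, rfl⟩
  exact ⟨v ++ w, (List.length_append ..).trans_le (add_le_add hv hw), by simp [wordEval_append]⟩

theorem transpose_mem_wordSpan (hp : p ∈ wordSpan X Y m) : (p.1ᵀ, p.2ᵀ) ∈ wordSpan X Y m := by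
  induction hp using Submodule.span_induction with
  | mem p hp =>
    obtain ⟨w, hw, rfl⟩ := hp
    simp only [← wordEval_transposeWord]
    exact wordEval_mem_wordSpan ((length_transposeWord w).trans_le hw)
  | zero => exact (Matrix.transpose_zero (α := K)).symm ▸ (wordSpan X Y m).zero_mem
  | add p q _ _ hp hq => simpa using (wordSpan X Y m).add_mem hp hq
  | smul a p _ hp => simpa using (wordSpan X Y m).smul_mem a hp

/-- The tuples `X` and `Y` have the same traces of words of length at most `D`. -/
def TracesAgree (X Y : Fin d → Matrix (Fin n) (Fin n) K) (D : ℕ) : Prop :=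
  ∀ w : List (Fin d × Bool), w.length ≤ D → (wordEval X w).trace = (wordEval Y w).trace

namespace TracesAgree

theorem mono (h : TracesAgree X Y m') (hm : m ≤ m') : TracesAgree X Y m :=
  fun w hw => h w (hw.trans hm)

theorem trace_eq (h : TracesAgree X Y m) (hp : p ∈ wordSpan X Y m) : p.1.trace = p.2.trace := by
  induction hp using Submodule.span_induction with
  | mem p hp => obtain ⟨w, hw, rfl⟩ := hp; exact h w hw
  | zero => simp
  | add p q _ _ hp hq => simp [hp, hq]
  | smul a p _ hp => simp [hp]

theorem eq_zero_iff [IsSemireal K] (h : TracesAgree X Y (m + m)) (hp : p ∈ wordSpan X Y m) :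
    p.1 = 0 ↔ p.2 = 0 := by
  have trace_eq : (p.1ᵀ * p.1).trace = (p.2ᵀ * p.2).trace :=
    h.trace_eq (mul_mem_wordSpan (transpose_mem_wordSpan hp) hp)
  constructor <;> intro h0 <;> refine eq_zero_of_trace_transpose_mul ?_
  · rw [← trace_eq, h0]; simp
  · rw [trace_eq, h0]; simp

theorem eq_iff [IsSemireal K] (h : TracesAgree X Y (m + m)) (hp : p ∈ wordSpan X Y m)
    (hq : q ∈ wordSpan X Y m) : p.1 = q.1 ↔ p.2 = q.2 := by
  rw [← sub_eq_zero, ← sub_eq_zero (a := p.2)]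
  exact h.eq_zero_iff (sub_mem hp hq)

theorem eq_scalar_iff [IsSemireal K] (h : TracesAgree X Y (m + m)) (hp : p ∈ wordSpan X Y m)
    (a : K) : p.1 = Matrix.scalar (Fin n) a ↔ p.2 = Matrix.scalar (Fin n) a :=
  h.eq_iff hp (scalar_mem_wordSpan a)

end TracesAgree

end Words

section Reduction

theorem exists_spanning_tuple {K V ι : Type*} [Field K] [AddCommGroup V] [Module K V]
    [FiniteDimensional K V] [Nonempty ι] (p : ι → V) :
    ∃ e : Fin (Module.finrank K V) → ι, ∀ i, p i ∈ Submodule.span K (Set.range (p ∘ e)) := by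
  classical
  obtain ⟨f, hf, hspan, -⟩ := Submodule.exists_fun_fin_finrank_span_eq K (Set.range p)
  choose e he using hf
  let r := Module.finrank K (Submodule.span K (Set.range p))
  have hr : r ≤ Module.finrank K V := Submodule.finrank_le _
  refine ⟨fun i => if h : (i : ℕ) < r then e ⟨i, h⟩ else Classical.arbitrary ι, fun i => ?_⟩
  have hi : p i ∈ Submodule.span K (Set.range f) := by
    rw [hspan]
    exact Submodule.subset_span (Set.mem_range_self i)
  refine Submodule.span_mono ?_ hi
  rintro _ ⟨k, rfl⟩
  exact ⟨⟨k, k.2.trans_le hr⟩, by simp [he, r]⟩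

variable {F : Type u} [Field F] {n : ℕ}

/-- The dimension of the space of pairs of matrices. -/
abbrev pairDim (n : ℕ) : ℕ := n * n + n * n

theorem exists_orthogonallyConjugate_of_comp {ι : Type*} [Nonempty ι]
    (X Y : ι → Matrix (Fin n) (Fin n) F) :
    ∃ e : Fin (pairDim n) → ι,
      OrthogonallyConjugate (X ∘ e) (Y ∘ e) → OrthogonallyConjugate X Y := by
  have finrank_eq : Module.finrank F
      (Matrix (Fin n) (Fin n) F × Matrix (Fin n) (Fin n) F) = pairDim n := by
    simp [Module.finrank_prod, Module.finrank_matrix]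
  obtain ⟨e, he⟩ : ∃ e : Fin (pairDim n) → ι, ∀ i,
      (X i, Y i) ∈ Submodule.span F (Set.range ((fun i => (X i, Y i)) ∘ e)) :=
    finrank_eq ▸ exists_spanning_tuple fun i => (X i, Y i)
  exact ⟨e, fun h => h.of_mem_span he⟩

theorem SpechtProperty.of_pairDim {D : ℕ} (h : ∀ X Y : Fin (pairDim n) → Matrix (Fin n) (Fin n) F,
    TracesAgree X Y D → OrthogonallyConjugate X Y) : SpechtProperty F n := by
  refine ⟨D, fun d X Y hXY => ?_⟩
  rcases isEmpty_or_nonempty (Fin d) with hd | hd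
  · exact ⟨1, by simp, isEmptyElim⟩
  obtain ⟨e, he⟩ := exists_orthogonallyConjugate_of_comp X Y
  refine he (h (X ∘ e) (Y ∘ e) fun w hw => ?_)
  simpa [wordEval, Function.comp_def] using
    hXY (w.map fun p => (e p.1, p.2)) (by simpa using hw)

end Reduction

/-! ### The language of matrix structures -/

namespace matLang

open Structure TupleInterpretation

variable {L : FirstOrder.Language.{v, w}} {k n : ℕ} {α K : Type*}

/-- The symbols of the language of rings, in the language of matrix structures. -/
abbrev ringFun (f : Language.ring.Functions k) : (matLang L).Functions k := Sum.inl (Sum.inl f)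

/-- The new function symbols, in the language of matrix structures. -/
abbrev newFun (f : L.Functions k) : (matLang L).Functions k := Sum.inl (Sum.inr f)

/-- The new relation symbols, in the language of matrix structures. -/
abbrev newRel (r : L.Relations k) : (matLang L).Relations k := Sum.inl (Sum.inr r)

/-- The symbol for the trace. -/
abbrev trFun : (matLang L).Functions 1 := Sum.inr TrInvFunc.tr

/-- The symbol for the transposition. -/
abbrev invFun : (matLang L).Functions 1 := Sum.inr TrInvFunc.inv

theorem functions_cases {P : ∀ k : ℕ, (matLang L).Functions k → Prop}
    (add : P 2 (ringFun addFunc)) (mul : P 2 (ringFun mulFunc)) (neg : P 1 (ringFun negFunc))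
    (zero : P 0 (ringFun zeroFunc)) (one : P 0 (ringFun oneFunc))
    (new : ∀ k (f : L.Functions k), P k (newFun f)) (tr : P 1 trFun) (inv : P 1 invFun)
    (f : (matLang L).Functions k) : P k f := by
  rcases f with (f | f) | f
  · cases f
    exacts [add, mul, neg, zero, one]
  · exact new _ f
  · cases f
    exacts [tr, inv]

theorem relations_cases {P : ∀ k : ℕ, (matLang L).Relations k → Prop}
    (new : ∀ k (r : L.Relations k), P k (newRel r)) (r : (matLang L).Relations k) : P k r := by
  rcases r with (r | r) | r
  · exact r.elim
  · exact new _ r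
  · exact r.elim

section Structure

variable [Field K] [L.Structure K]

theorem funMap_tr (X : Fin 1 → Matrix (Fin n) (Fin n) K) :
    funMap (L := matLang L) trFun X = Matrix.scalar (Fin n) (X 0).trace := rfl

theorem funMap_newFun_of_not (f : L.Functions k) {X : Fin k → Matrix (Fin n) (Fin n) K}
    (h : ¬ ∃ a : Fin k → K, ∀ i, X i = Matrix.scalar (Fin n) (a i)) :
    funMap (L := matLang L) (newFun f) X = 0 :=
  dif_neg h

theorem relMap_newRel (r : L.Relations k) (X : Fin k → Matrix (Fin n) (Fin n) K) :
    RelMap (L := matLang L) (newRel r) X ↔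
      ∃ a : Fin k → K, (∀ i, X i = Matrix.scalar (Fin n) (a i)) ∧ RelMap r a := Iff.rfl

variable [NeZero n]

theorem funMap_newFun_scalar (f : L.Functions k) {X : Fin k → Matrix (Fin n) (Fin n) K}
    {a : Fin k → K} (h : ∀ i, X i = Matrix.scalar (Fin n) (a i)) :
    funMap (L := matLang L) (newFun f) X = Matrix.scalar (Fin n) (funMap f a) := by
  have h' : ∃ a : Fin k → K, ∀ i, X i = Matrix.scalar (Fin n) (a i) := ⟨a, h⟩
  have choose_eq : h'.choose = a :=
    funext fun i => Matrix.scalar_inj.1 ((h'.choose_spec i).symm.trans (h i))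
  rw [← choose_eq]
  exact dif_pos h'

theorem relMap_newRel_scalar (r : L.Relations k) {X : Fin k → Matrix (Fin n) (Fin n) K}
    {a : Fin k → K} (h : ∀ i, X i = Matrix.scalar (Fin n) (a i)) :
    RelMap (L := matLang L) (newRel r) X ↔ RelMap r a := by
  refine (relMap_newRel r X).trans ⟨fun ⟨b, hb, hr⟩ => ?_, fun hr => ⟨a, h, hr⟩⟩
  rwa [← show b = a from funext fun i => Matrix.scalar_inj.1 ((hb i).symm.trans (h i))]

theorem exists_scalar_iff (X : Fin k → Matrix (Fin n) (Fin n) K) :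
    (∃ a : Fin k → K, ∀ i, X i = Matrix.scalar (Fin n) (a i)) ↔
      ∀ i, X i = Matrix.scalar (Fin n) (X i 0 0) := by
  refine ⟨fun ⟨a, ha⟩ i => ?_, fun h => ⟨_, h⟩⟩
  rw [ha i]
  simp

end Structure

/-! ### Matrices as tuples of entries -/

/-- A matrix as the tuple of its entries. -/
def entries : Matrix (Fin n) (Fin n) K ≃ (Fin n × Fin n → K) :=
  Matrix.of.symm.trans (Equiv.curry _ _ _).symm

/-- The generic matrices, whose entries are independent indeterminates. -/
def generic (a : α) : Matrix (Fin n) (Fin n) (FreeCommRing (α × Fin n × Fin n)) :=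
  Matrix.of fun i j => FreeCommRing.of (a, i, j)

/-- The formula expressing that two matrices of integral polynomials have the same value. -/
noncomputable def matEq (A B : Matrix (Fin n) (Fin n) (FreeCommRing α)) :
    (fieldLang L).Formula α :=
  (LHom.sumInl : Language.ring →ᴸ fieldLang L).onFormula <|
    Formula.iInf fun p : Fin n × Fin n =>
      (termOfFreeCommRing (A p.1 p.2)).equal (termOfFreeCommRing (B p.1 p.2))

variable [Field K]

theorem mapMatrix_generic (X : α → Matrix (Fin n) (Fin n) K) (a : α) :
    (FreeCommRing.lift (coords entries X)).mapMatrix (generic a) = X a := by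
  ext i j
  exact FreeCommRing.lift_of _ _

variable [CompatibleRing K] [L.Structure K]

@[simp] theorem realize_matEq (A B : Matrix (Fin n) (Fin n) (FreeCommRing α)) (v : α → K) :
    (matEq A B : (fieldLang L).Formula α).Realize v ↔
      (FreeCommRing.lift v).mapMatrix A = (FreeCommRing.lift v).mapMatrix B := by
  simp [matEq, Formula.realize_iInf, ← Matrix.ext_iff]

/-- The formula expressing that a matrix is scalar. -/
noncomputable def isScalar [NeZero n] (a : α) : (fieldLang L).Formula (α × Fin n × Fin n) :=
  matEq (generic a) (Matrix.scalar (Fin n) (generic a 0 0))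

theorem mapMatrix_scalar {R S : Type*} [CommRing R] [CommRing S] (f : R →+* S) (a : R) :
    f.mapMatrix (Matrix.scalar (Fin n) a) = Matrix.scalar (Fin n) (f a) := by
  ext i j
  by_cases h : i = j <;> simp [h]

@[simp] theorem realize_isScalar [NeZero n] (a : α) (X : α → Matrix (Fin n) (Fin n) K) :
    (isScalar a : (fieldLang L).Formula _).Realize (coords entries X) ↔
      X a = Matrix.scalar (Fin n) (X a 0 0) := by
  rw [isScalar, realize_matEq, mapMatrix_generic, mapMatrix_scalar]
  exact Eq.congr_right (congrArg _ (FreeCommRing.lift_of _ _))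

/-- The graph of a ring operation on matrices. -/
noncomputable def ringGraph :
    Language.ring.Functions k → (fieldLang L).Formula ((Fin k ⊕ Unit) × Fin n × Fin n)
  | .add => matEq (generic (.inr ())) (generic (.inl 0) + generic (.inl 1))
  | .mul => matEq (generic (.inr ())) (generic (.inl 0) * generic (.inl 1))
  | .neg => matEq (generic (.inr ())) (-generic (.inl 0))
  | .zero => matEq (generic (.inr ())) 0
  | .one => matEq (generic (.inr ())) 1

/-- The graph of a new function on matrices. -/
noncomputable def newGraph [NeZero n] (f : L.Functions k) :
    (fieldLang L).Formula ((Fin k ⊕ Unit) × Fin n × Fin n) :=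
  let scalarArgs := Formula.iInf fun i : Fin k => isScalar (.inl i)
  let value := Term.func (Sum.inr f : (fieldLang L).Functions k) fun i => .var (.inl i, 0, 0)
  (scalarArgs ⊓ (isScalar (.inr ()) ⊓ (Term.var (.inr (), 0, 0)).equal value)) ⊔
    (scalarArgs.not ⊓ matEq (generic (.inr ())) 0)

/-- The graphs of the trace and of the transposition. -/
noncomputable def trInvGraph :
    trInvLang.Functions k → (fieldLang L).Formula ((Fin k ⊕ Unit) × Fin n × Fin n)
  | .tr => matEq (generic (.inr ())) (Matrix.scalar (Fin n) (generic (.inl 0)).trace)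
  | .inv => matEq (generic (.inr ())) (generic (.inl 0))ᵀ

/-- The interpretation of the matrix structure over an expanded field in the field. -/
noncomputable def entryInterpretation (L : FirstOrder.Language.{v, w}) (n : ℕ) [NeZero n] :
    TupleInterpretation (matLang L) (fieldLang L) (Fin n × Fin n) where
  funGraph := Sum.elim (Sum.elim ringGraph newGraph) trInvGraph
  rel {k} := Sum.elim (Sum.elim Empty.elim fun r =>
    (Formula.iInf fun i : Fin k => isScalar i) ⊓
      Relations.formula (Sum.inr r : (fieldLang L).Relations k) fun i => .var (i, 0, 0)) Empty.elim

variable [NeZero n]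

theorem realize_newGraph (f : L.Functions k) (X : Fin k → Matrix (Fin n) (Fin n) K)
    (Y : Unit → Matrix (Fin n) (Fin n) K) :
    (newGraph f).Realize (coords entries (Sum.elim X Y)) ↔
      Y () = funMap (L := matLang L) (newFun f) X := by
  have value : (Term.equal (L := fieldLang L) (.var (.inr (), 0, 0))
        (.func (Sum.inr f) fun i => .var (.inl i, 0, 0))).Realize (coords entries (Sum.elim X Y)) ↔
      Y () 0 0 = funMap f fun i => X i 0 0 := by rw [Formula.realize_equal]; rfl
  simp only [newGraph, Formula.realize_sup, Formula.realize_inf, Formula.realize_not,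
    Formula.realize_iInf, realize_isScalar, realize_matEq, mapMatrix_generic, map_zero, value,
    Sum.elim_inl, Sum.elim_inr]
  by_cases hX : ∀ i, X i = Matrix.scalar (Fin n) (X i 0 0)
  · rw [funMap_newFun_scalar f hX]
    simp only [eq_true hX, true_and, not_true_eq_false, false_and, or_false]
    refine ⟨fun ⟨hY, h⟩ => h ▸ hY, fun h => ?_⟩
    simp [h]
  · rw [funMap_newFun_of_not f ((exists_scalar_iff X).not.2 hX)]
    simp only [hX, false_and, not_false_eq_true, true_and, false_or]

theorem holds_entryInterpretation :
    (entryInterpretation L n).Holds (entries : Matrix (Fin n) (Fin n) K ≃ _) where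
  realize_funGraph f := by
    induction f using functions_cases with
    | new k f => exact realize_newGraph f
    | tr =>
      intro X Y
      refine (realize_matEq _ _ _).trans ?_
      rw [mapMatrix_generic, mapMatrix_scalar, AddMonoidHom.map_trace, ← RingHom.mapMatrix_apply,
        mapMatrix_generic]
      rfl
    | inv =>
      intro X Y
      refine (realize_matEq _ _ _).trans ?_
      rw [mapMatrix_generic, RingHom.mapMatrix_apply, Matrix.transpose_map,
        ← RingHom.mapMatrix_apply, mapMatrix_generic]
      rfl
    | _ =>
      intro X Y
      refine (realize_matEq _ _ _).trans ?_
      simp only [map_add, map_mul, map_neg, map_zero, map_one, mapMatrix_generic]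
      rfl
  realize_rel r := by
    induction r using relations_cases with
    | new k r =>
      intro X
      change ((Formula.iInf fun i => isScalar i) ⊓ Relations.formula (Sum.inr r) _).Realize _ ↔ _
      simp only [Formula.realize_inf, Formula.realize_iInf, realize_isScalar]
      refine ⟨fun h => ⟨_, h⟩, fun h => ?_⟩
      have hX := (exists_scalar_iff X).1 (h.imp fun _ => And.left)
      exact ⟨hX, (relMap_newRel_scalar r hX).1 h⟩

end matLang

namespace matLang

open Structure TupleInterpretation

section Maps

variable {L : FirstOrder.Language.{v, w}} {n : ℕ} {K K' : Type*} [Field K] [CompatibleRing K]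
  [L.Structure K] [Field K'] [CompatibleRing K'] [L.Structure K']

theorem elementarilyEquivalent_matrix [NeZero n] (h : K ≅[fieldLang L] K') :
    Matrix (Fin n) (Fin n) K ≅[matLang L] Matrix (Fin n) (Fin n) K' :=
  holds_entryInterpretation.elementarilyEquivalent holds_entryInterpretation h

/-- The entrywise extension of an elementary embedding of expanded fields. -/
noncomputable def mapEmbedding [NeZero n] (j : K ↪ₑ[fieldLang L] K') :
    Matrix (Fin n) (Fin n) K ↪ₑ[matLang L] Matrix (Fin n) (Fin n) K' :=
  holds_entryInterpretation.elementaryEmbedding holds_entryInterpretation j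

@[simp] theorem mapEmbedding_apply [NeZero n] (j : K ↪ₑ[fieldLang L] K')
    (X : Matrix (Fin n) (Fin n) K) : mapEmbedding j X = X.map j :=
  rfl

end Maps

section Automorphisms

variable {L : FirstOrder.Language.{v, w}} {n : ℕ} {K : Type*} [Field K] [L.Structure K]

theorem map_eq_scalar_iff (g : Matrix (Fin n) (Fin n) K ≃ₐ[K] Matrix (Fin n) (Fin n) K)
    (X : Matrix (Fin n) (Fin n) K) (a : K) :
    g X = Matrix.scalar (Fin n) a ↔ X = Matrix.scalar (Fin n) a := by
  have map_scalar : g (Matrix.scalar (Fin n) a) = Matrix.scalar (Fin n) a := g.commutes a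
  exact ⟨fun h => g.injective (h.trans map_scalar.symm), fun h => h ▸ map_scalar⟩

variable [NeZero n]

/-- An algebra automorphism that preserves traces and transposes is an automorphism of the matrix
structure. -/
noncomputable def equivOfAlgEquiv
    (g : Matrix (Fin n) (Fin n) K ≃ₐ[K] Matrix (Fin n) (Fin n) K)
    (trace_eq : ∀ X, (g X).trace = X.trace) (transpose_eq : ∀ X, g Xᵀ = (g X)ᵀ) :
    Matrix (Fin n) (Fin n) K ≃[matLang L] Matrix (Fin n) (Fin n) K where
  toEquiv := g.toEquiv
  map_fun' f X := by
    change g (funMap f X) = funMap f (g ∘ X)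
    induction f using functions_cases with
    | add => exact map_add g _ _
    | mul => exact map_mul g _ _
    | neg => exact map_neg g _
    | zero => exact map_zero g
    | one => exact map_one g
    | new k f =>
      by_cases hX : ∃ a : Fin k → K, ∀ i, X i = Matrix.scalar (Fin n) (a i)
      · obtain ⟨a, ha⟩ := hX
        rw [funMap_newFun_scalar f ha, (map_eq_scalar_iff g _ _).2 rfl,
          funMap_newFun_scalar (X := g ∘ X) f fun i => (map_eq_scalar_iff g _ _).2 (ha i)]
      · rw [funMap_newFun_of_not f hX, map_zero, funMap_newFun_of_not f]
        simpa only [Function.comp_apply, map_eq_scalar_iff] using hX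
    | tr =>
      rw [funMap_tr, funMap_tr, (map_eq_scalar_iff g _ _).2 rfl, Function.comp_apply, trace_eq]
    | inv => exact transpose_eq _
  map_rel' r X := by
    change RelMap r (g ∘ X) ↔ RelMap r X
    induction r using relations_cases with
    | new k r => simp only [relMap_newRel, Function.comp_apply, map_eq_scalar_iff]

/-- Conjugation by an orthogonal matrix. -/
noncomputable def conjEquiv (O : Matrix (Fin n) (Fin n) K) (hO : O * Oᵀ = 1) :
    Matrix (Fin n) (Fin n) K ≃[matLang L] Matrix (Fin n) (Fin n) K :=
  let u : (Matrix (Fin n) (Fin n) K)ˣ := ⟨Oᵀ, O, mul_eq_one_comm.1 hO, hO⟩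
  equivOfAlgEquiv (MulSemiringAction.toAlgEquiv K _ (ConjAct.toConjAct u))
    (fun X => by
      change (Oᵀ * X * O).trace = _
      rw [Matrix.trace_mul_comm, ← mul_assoc, hO, one_mul])
    (fun X => by
      change Oᵀ * Xᵀ * O = (Oᵀ * X * O)ᵀ
      simp [Matrix.mul_assoc])

end Automorphisms

/-! ### Quantifier elimination on scalar matrices -/

section Scalar

variable {L : FirstOrder.Language.{v, w}} {n : ℕ} {α K : Type*} [Field K] [L.Structure K]

/-- The inclusion of the language of the expanded field. -/
def ofField : fieldLang L →ᴸ matLang L := LHom.sumInl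

/-- The matrix structure as a structure for the language of the expanded field. -/
noncomputable instance fieldReduct : (fieldLang L).Structure (Matrix (Fin n) (Fin n) K) :=
  ofField.reduct _

instance isExpansionOn_ofField :
    (ofField : fieldLang L →ᴸ matLang L).IsExpansionOn (Matrix (Fin n) (Fin n) K) :=
  LHom.isExpansionOn_reduct _ _

variable [CompatibleRing K] [NeZero n]

/-- The expanded field embeds in the matrix structure as the scalar matrices. -/
def scalarEmbedding : K ↪[fieldLang L] Matrix (Fin n) (Fin n) K where
  toFun := Matrix.scalar (Fin n)
  inj' _ _ := Matrix.scalar_inj.1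
  map_fun' {k} f a := by
    rcases f with f | f
    · cases f with
      | add =>
        exact (congrArg _ (CompatibleRing.funMap_add a)).trans (map_add (Matrix.scalar _) _ _)
      | mul =>
        exact (congrArg _ (CompatibleRing.funMap_mul a)).trans (map_mul (Matrix.scalar _) _ _)
      | neg => exact (congrArg _ (CompatibleRing.funMap_neg a)).trans (map_neg (Matrix.scalar _) _)
      | zero => exact (congrArg _ (CompatibleRing.funMap_zero a)).trans (map_zero (Matrix.scalar _))
      | one => exact (congrArg _ (CompatibleRing.funMap_one a)).trans (map_one (Matrix.scalar _))
    · exact (funMap_newFun_scalar f fun _ => rfl).symm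
  map_rel' {k} r a := by
    rcases r with r | r
    · exact r.elim
    · exact relMap_newRel_scalar r fun _ => rfl

theorem realize_onFormula_scalar_iff {φ : (fieldLang L).Formula α} (hφ : BoundedFormula.IsQF φ)
    (a : α → K) :
    (ofField.onFormula φ).Realize (fun i => Matrix.scalar (Fin n) (a i)) ↔ φ.Realize a :=
  (LHom.realize_onFormula _ φ).trans (realize_comp_embedding_iff scalarEmbedding hφ a)

theorem exists_isQF_realize_scalar_iff (hK : HasQE (fieldLang L) K)
    (φ : (matLang L).Formula α) :
    ∃ ψ : (matLang L).Formula α, BoundedFormula.IsQF ψ ∧ ∀ a : α → K,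
      φ.Realize (fun i => Matrix.scalar (Fin n) (a i)) ↔
        ψ.Realize fun i => Matrix.scalar (Fin n) (a i) := by
  let entry : α × Fin n × Fin n → (fieldLang L).Term α := fun p =>
    if p.2.1 = p.2.2 then .var p.1 else (LHom.sumInl : Language.ring →ᴸ _).onTerm 0
  have realize_entry (a : α → K) : (fun p => (entry p).realize a) =
      coords entries fun i => Matrix.scalar (Fin n) (a i) := by
    ext ⟨c, i, j⟩
    by_cases hij : i = j
    · simp [entry, coords, entries, hij]
    · simp [entry, coords, entries, hij]
  obtain ⟨ψ, hψ, h⟩ := hK.exists_isQF (((entryInterpretation L n).translateFormula φ).subst entry)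
  refine ⟨ofField.onFormula ψ, isQF_onBoundedFormula _ hψ, fun a => ?_⟩
  rw [← holds_entryInterpretation.realize_translateFormula, ← realize_entry]
  exact (BoundedFormula.realize_subst.symm.trans (h a)).trans
    (realize_onFormula_scalar_iff hψ a).symm

end Scalar

end matLang

namespace matLang

open Structure

/-! ### Terms -/

section Terms

variable {L : FirstOrder.Language.{v, w}} {α : Type*}

instance : Add ((matLang L).Term α) := ⟨(ringFun addFunc).apply₂⟩

instance : Mul ((matLang L).Term α) := ⟨(ringFun mulFunc).apply₂⟩

instance : Zero ((matLang L).Term α) := ⟨Constants.term (ringFun zeroFunc)⟩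

instance : One ((matLang L).Term α) := ⟨Constants.term (ringFun oneFunc)⟩

/-- The transpose of a term. -/
def invTerm (t : (matLang L).Term α) : (matLang L).Term α := invFun.apply₁ t

/-- The trace of a term, as a scalar matrix. -/
def trTerm (t : (matLang L).Term α) : (matLang L).Term α := trFun.apply₁ t

/-- The word `w` in the terms `X`. -/
def wordTerm {d : ℕ} (X : Fin d → (matLang L).Term α) (w : List (Fin d × Bool)) :
    (matLang L).Term α :=
  (w.map fun p => if p.2 then invTerm (X p.1) else X p.1).prod

variable {n : ℕ} {K : Type*} [Field K] [L.Structure K] (a : α → Matrix (Fin n) (Fin n) K)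

@[simp] theorem realize_add (s t : (matLang L).Term α) :
    (s + t).realize a = s.realize a + t.realize a :=
  Term.realize_functions_apply₂

@[simp] theorem realize_mul (s t : (matLang L).Term α) :
    (s * t).realize a = s.realize a * t.realize a :=
  Term.realize_functions_apply₂

@[simp] theorem realize_zero : (0 : (matLang L).Term α).realize a = 0 :=
  Term.realize_constants

@[simp] theorem realize_one : (1 : (matLang L).Term α).realize a = 1 :=
  Term.realize_constants

@[simp] theorem realize_invTerm (t : (matLang L).Term α) :
    (invTerm t).realize a = (t.realize a)ᵀ :=
  Term.realize_functions_apply₁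

@[simp] theorem realize_trTerm (t : (matLang L).Term α) :
    (trTerm t).realize a = Matrix.scalar (Fin n) (t.realize a).trace :=
  Term.realize_functions_apply₁

@[simp] theorem realize_sum (l : List ((matLang L).Term α)) :
    l.sum.realize a = (l.map fun t => t.realize a).sum := by
  induction l with
  | nil => exact realize_zero a
  | cons t l ih => rw [List.sum_cons, realize_add, ih, List.map_cons, List.sum_cons]

@[simp] theorem realize_wordTerm {d : ℕ} (X : Fin d → (matLang L).Term α)
    (w : List (Fin d × Bool)) :
    (wordTerm X w).realize a = wordEval (fun i => (X i).realize a) w := by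
  induction w with
  | nil => exact realize_one a
  | cons p w ih =>
    rw [wordEval_cons, ← ih, wordTerm, List.map_cons, List.prod_cons, realize_mul, wordTerm]
    split_ifs <;> simp only [realize_invTerm]

end Terms

/-! ### Quantifier-free formulas see only traces of bounded words -/

section WordSpan

variable {L : FirstOrder.Language.{v, w}} {n d k m : ℕ} {α K : Type*} [Field K] [IsSemireal K]
  [L.Structure K] {X Y : Fin d → Matrix (Fin n) (Fin n) K}

theorem relMap_iff_of_mem_wordSpan (h : TracesAgree X Y (m + m)) (r : (matLang L).Relations k)
    {A B : Fin k → Matrix (Fin n) (Fin n) K} (hAB : ∀ i, (A i, B i) ∈ wordSpan X Y m) :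
    RelMap r A ↔ RelMap r B := by
  induction r using relations_cases with
  | new k r =>
    simp only [relMap_newRel]
    exact exists_congr fun a => and_congr_left fun _ =>
      forall_congr' fun i => h.eq_scalar_iff (hAB i) _

variable [NeZero n]

theorem funMap_mem_wordSpan (h : TracesAgree X Y (m + m)) (f : (matLang L).Functions k)
    {A B : Fin k → Matrix (Fin n) (Fin n) K} (hAB : ∀ i, (A i, B i) ∈ wordSpan X Y m) :
    (funMap f A, funMap f B) ∈ wordSpan X Y (m + m) := by
  have hm : wordSpan X Y m ≤ wordSpan X Y (m + m) := wordSpan_mono (Nat.le_add_left _ _)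
  induction f using functions_cases with
  | add => exact hm (add_mem (hAB 0) (hAB 1))
  | mul => exact mul_mem_wordSpan (hAB 0) (hAB 1)
  | neg => exact hm (neg_mem (hAB 0))
  | zero => exact (wordSpan X Y (m + m)).zero_mem
  | one => exact wordEval_mem_wordSpan (w := []) (Nat.zero_le _)
  | new k f =>
    have scalar_iff (a : Fin k → K) : (∀ i, A i = Matrix.scalar (Fin n) (a i)) ↔
        ∀ i, B i = Matrix.scalar (Fin n) (a i) :=
      forall_congr' fun i => h.eq_scalar_iff (hAB i) _
    by_cases hA : ∃ a : Fin k → K, ∀ i, A i = Matrix.scalar (Fin n) (a i)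
    · obtain ⟨a, ha⟩ := hA
      rw [funMap_newFun_scalar f ha, funMap_newFun_scalar f ((scalar_iff a).1 ha)]
      exact scalar_mem_wordSpan _
    · rw [funMap_newFun_of_not f hA, funMap_newFun_of_not f fun ⟨a, ha⟩ =>
        hA ⟨a, (scalar_iff a).2 ha⟩]
      exact (wordSpan X Y (m + m)).zero_mem
  | tr =>
    rw [funMap_tr, funMap_tr, (h.mono (Nat.le_add_left m m)).trace_eq (hAB 0)]
    exact scalar_mem_wordSpan _
  | inv => exact hm (transpose_mem_wordSpan (hAB 0))

/-- A bound on the length of the words needed to express the value of a term. -/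
def wordBound : (matLang L).Term α → ℕ
  | .var _ => 1
  | .func _ ts => (Finset.univ.sup fun i => wordBound (ts i)) +
      Finset.univ.sup fun i => wordBound (ts i)

theorem realize_mem_wordSpan {a b : α → Matrix (Fin n) (Fin n) K}
    (hab : ∀ i, (a i, b i) ∈ wordSpan X Y 1) (t : (matLang L).Term α) (hm : wordBound t ≤ m)
    (h : TracesAgree X Y m) : (t.realize a, t.realize b) ∈ wordSpan X Y m := by
  induction t generalizing m with
  | var i => exact wordSpan_mono hm (hab i)
  | func f ts ih =>
    have h' := h.mono hm
    refine wordSpan_mono hm (funMap_mem_wordSpan h' f fun i => ?_)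
    exact ih i (Finset.le_sup (f := fun i => wordBound (ts i)) (Finset.mem_univ i))
      (h'.mono (Nat.le_add_left _ _))

theorem exists_realize_iff_of_isAtomic {φ : (matLang L).BoundedFormula α k} (hφ : φ.IsAtomic) :
    ∃ D, ∀ (X Y : Fin d → Matrix (Fin n) (Fin n) K) (a b : α → Matrix (Fin n) (Fin n) K)
      (a' b' : Fin k → Matrix (Fin n) (Fin n) K),
      (∀ i, (Sum.elim a a' i, Sum.elim b b' i) ∈ wordSpan X Y 1) → TracesAgree X Y D →
        (φ.Realize a a' ↔ φ.Realize b b') := by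
  cases hφ with
  | equal t₁ t₂ =>
    let m := max (wordBound t₁) (wordBound t₂)
    refine ⟨m + m, fun X Y a b a' b' hab h => ?_⟩
    have hm := h.mono (Nat.le_add_left m m)
    rw [BoundedFormula.realize_bdEqual, BoundedFormula.realize_bdEqual]
    exact h.eq_iff (realize_mem_wordSpan hab t₁ (le_max_left _ _) hm)
      (realize_mem_wordSpan hab t₂ (le_max_right _ _) hm)
  | rel r ts =>
    let m := Finset.univ.sup fun i => wordBound (ts i)
    refine ⟨m + m, fun X Y a b a' b' hab h => ?_⟩
    rw [BoundedFormula.realize_rel, BoundedFormula.realize_rel]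
    exact relMap_iff_of_mem_wordSpan h r fun i => realize_mem_wordSpan hab (ts i)
      (Finset.le_sup (f := fun i => wordBound (ts i)) (Finset.mem_univ i))
      (h.mono (Nat.le_add_left m m))

theorem exists_realize_iff_of_isQF {φ : (matLang L).BoundedFormula α k} (hφ : φ.IsQF) :
    ∃ D, ∀ (X Y : Fin d → Matrix (Fin n) (Fin n) K) (a b : α → Matrix (Fin n) (Fin n) K)
      (a' b' : Fin k → Matrix (Fin n) (Fin n) K),
      (∀ i, (Sum.elim a a' i, Sum.elim b b' i) ∈ wordSpan X Y 1) → TracesAgree X Y D →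
        (φ.Realize a a' ↔ φ.Realize b b') := by
  induction hφ with
  | falsum => exact ⟨0, fun _ _ _ _ _ _ _ _ => Iff.rfl⟩
  | of_isAtomic h => exact exists_realize_iff_of_isAtomic h
  | imp _ _ ih₁ ih₂ =>
    obtain ⟨D₁, h₁⟩ := ih₁
    obtain ⟨D₂, h₂⟩ := ih₂
    exact ⟨max D₁ D₂, fun X Y a b a' b' hab h =>
      imp_congr (h₁ X Y a b a' b' hab (h.mono (le_max_left _ _)))
        (h₂ X Y a b a' b' hab (h.mono (le_max_right _ _)))⟩

end WordSpan

/-! ### Quantifier elimination implies the Specht property -/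

section Column

variable {L : FirstOrder.Language.{v, w}} {n d : ℕ} [NeZero n] {K : Type*} [Field K]
  [L.Structure K]

/-- The formula in matrices `X k` and scalars `c k i j` which says that, for some `G` that
multiplies like the matrix units `E i 0`, left multiplication by `X k` has the matrix `c k` with
respect to `G`. -/
noncomputable def columnFormula (L : FirstOrder.Language.{v, w}) (d n : ℕ) [NeZero n] :
    (matLang L).Formula (Fin d ⊕ Fin d × Fin n × Fin n) :=
  let X (k : Fin d) : (matLang L).Term ((Fin d ⊕ Fin d × Fin n × Fin n) ⊕ Fin n) :=
    .var (.inl (.inl k))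
  let c (k : Fin d) (i j : Fin n) :
      (matLang L).Term ((Fin d ⊕ Fin d × Fin n × Fin n) ⊕ Fin n) := .var (.inl (.inr (k, i, j)))
  let G (i : Fin n) : (matLang L).Term ((Fin d ⊕ Fin d × Fin n × Fin n) ⊕ Fin n) := .var (.inr i)
  Formula.iExs (Fin n) <|
    (Formula.iInf fun p : Fin n × Fin n =>
      (invTerm (G p.1) * G p.2).equal (if p.1 = p.2 then G 0 else 0)) ⊓
    ((∼ ((G 0).equal 0)) ⊓
    Formula.iInf fun p : Fin d × Fin n =>
      (X p.1 * G p.2).equal (List.ofFn fun j => c p.1 j p.2 * G j).sum)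

theorem realize_columnFormula (X C : Fin d → Matrix (Fin n) (Fin n) K) :
    (columnFormula L d n).Realize
        (Sum.elim X fun p => Matrix.scalar (Fin n) (C p.1 p.2.1 p.2.2)) ↔
      ∃ G, IsUnitColumn 0 G ∧ ∀ k i, X k * G i = ∑ j, C k j i • G j := by
  rw [columnFormula, Formula.realize_iExs]
  refine exists_congr fun G => ?_
  simp only [Formula.realize_inf, Formula.realize_iInf, Formula.realize_not, Prod.forall,
    Formula.realize_equal, realize_mul, realize_invTerm, realize_sum, List.map_ofFn,
    List.sum_ofFn, Term.realize_var, Sum.elim_inl, Sum.elim_inr, Function.comp_apply,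
    apply_ite (Term.realize _), realize_zero, Matrix.scalar_apply, ← Matrix.smul_eq_diagonal_mul,
    ← and_assoc, ← ne_eq]
  exact and_congr_left fun _ => ⟨fun h => ⟨h.1, h.2⟩, fun h => ⟨h.1, h.2⟩⟩

end Column

end matLang

theorem spechtProperty_of_hasQE {L : FirstOrder.Language.{v, w}} {F : Type u} [Field F]
    [IsSemireal F] (hF : IsPythagorean F) [L.Structure F] {n : ℕ} [NeZero n]
    (h : HasQE (matLang L) (Matrix (Fin n) (Fin n) F)) : SpechtProperty F n := by
  obtain ⟨ψ, hψ, hφψ⟩ := h.exists_isQF (matLang.columnFormula L (pairDim n) n)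
  obtain ⟨D, hD⟩ := matLang.exists_realize_iff_of_isQF (K := F) (n := n) (d := pairDim n) hψ
  refine SpechtProperty.of_pairDim (D := D) fun X Y hXY => ?_
  have column_X : (matLang.columnFormula L (pairDim n) n).Realize
      (Sum.elim X fun p => Matrix.scalar (Fin n) (X p.1 p.2.1 p.2.2)) :=
    (matLang.realize_columnFormula X X).2
      ⟨_, isUnitColumn_single 0, fun k i => mul_single_column 0 i (X k)⟩
  have column_Y : (matLang.columnFormula L (pairDim n) n).Realize
      (Sum.elim Y fun p => Matrix.scalar (Fin n) (X p.1 p.2.1 p.2.2)) := by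
    refine (hφψ _).2 ((hD X Y _ _ _ _ ?_ hXY).1 ((hφψ _).1 column_X))
    rintro ((i | i) | i)
    · exact letter_mem_wordSpan i le_rfl
    · exact scalar_mem_wordSpan _
    · exact i.elim0
  obtain ⟨G, hG, hYG⟩ := (matLang.realize_columnFormula Y X).1 column_Y
  obtain ⟨O, hO, hconj⟩ := hG.exists_orthogonal hF
  exact OrthogonallyConjugate.symm ⟨O, hO, fun k => hconj (X k) (Y k) (hYG k)⟩

/-! ### Transfer to elementarily equivalent fields -/

section Transfer

/-- The axioms of formally real Pythagorean fields. -/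
def realPythagoreanSentence : Language.ring.Sentence :=
  (∀' ∀' ∃' ((&0 * &0 + &1 * &1) =' (&2 * &2))) ⊓ ∀' ∼((&0 * &0 + 1) =' 0)

theorem isPythagorean_iff {K : Type u} [Field K] :
    IsPythagorean K ↔ ∀ x y : K, ∃ z, x * x + y * y = z * z := by
  refine ⟨fun h x y => h _ (.add (.mul_self x) (.mul_self y)), fun h a ha => ?_⟩
  induction ha with
  | zero => exact .zero
  | sq_add x _ ih =>
    obtain ⟨y, rfl⟩ := ih
    exact h x y

theorem IsPythagorean.isSemireal_iff {K : Type u} [Field K] (hK : IsPythagorean K) :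
    IsSemireal K ↔ ∀ x : K, x * x + 1 ≠ 0 := by
  refine ⟨fun _ x => ?_, fun h => ⟨fun {s} hs => ?_⟩⟩
  · rw [add_comm]
    exact IsSemireal.one_add_ne_zero (.mul_self x)
  · obtain ⟨x, rfl⟩ := hK s hs
    rw [add_comm]
    exact h x

theorem realize_realPythagoreanSentence {K : Type u} [Field K] [CompatibleRing K] :
    K ⊨ realPythagoreanSentence ↔ IsPythagorean K ∧ IsSemireal K := by
  have realize_iff : K ⊨ realPythagoreanSentence ↔
      (∀ x y : K, ∃ z, x * x + y * y = z * z) ∧ ∀ x : K, x * x + 1 ≠ 0 := by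
    simp [realPythagoreanSentence, Sentence.Realize, Formula.Realize, Fin.snoc]
  rw [realize_iff, ← isPythagorean_iff]
  exact and_congr_right fun hK => hK.isSemireal_iff.symm

variable {L : FirstOrder.Language.{v, w}} {K : Type u} {K' : Type x}

theorem realize_ring_iff_of_elementarilyEquivalent [Language.ring.Structure K]
    [L.Structure K] [Language.ring.Structure K'] [L.Structure K']
    (h : K ≅[fieldLang L] K') (φ : Language.ring.Sentence) : K ⊨ φ ↔ K' ⊨ φ := by
  simpa only [LHom.realize_onSentence] using
    elementarilyEquivalent_iff.1 h ((LHom.sumInl : Language.ring →ᴸ fieldLang L).onSentence φ)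

variable [Field K] [CompatibleRing K] [L.Structure K]

theorem exists_field_of_elementarilyEquivalent [S : (fieldLang L).Structure K']
    (h : K ≅[fieldLang L] K') :
    ∃ (_ : Field K') (_ : CompatibleRing K') (_ : L.Structure K'),
      S = Language.sumStructure Language.ring L K' := by
  let _ : Language.ring.Structure K' := (LHom.sumInl : Language.ring →ᴸ fieldLang L).reduct K'
  let _ : L.Structure K' := (LHom.sumInr : L →ᴸ fieldLang L).reduct K'
  have hS : S = Language.sumStructure Language.ring L K' := by
    ext m f x <;> rcases f with f | f <;> rfl
  rw [hS] at h
  have : Theory.field.Model K' := ⟨fun φ hφ =>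
    (realize_ring_iff_of_elementarilyEquivalent h φ).1 (Theory.realize_sentence_of_mem _ hφ)⟩
  let _ := FirstOrder.Field.fieldOfModelField K'
  exact ⟨_, FirstOrder.Field.compatibleRingOfModelField K', _, hS⟩

variable [Field K'] [CompatibleRing K'] [L.Structure K']

theorem IsPythagorean.of_elementarilyEquivalent [IsSemireal K] (hK : IsPythagorean K)
    (h : K ≅[fieldLang L] K') : IsPythagorean K' ∧ IsSemireal K' :=
  realize_realPythagoreanSentence.1 <| (realize_ring_iff_of_elementarilyEquivalent h _).1 <|
    realize_realPythagoreanSentence.2 ⟨hK, inferInstance⟩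

end Transfer

namespace matLang

section Specht

variable {L : FirstOrder.Language.{v, w}} {n d : ℕ} {α : Type*}

/-- The words of length at most `D` in the letters `x_i` and `x_i^t` with `i < d`. -/
abbrev BoundedWord (d D : ℕ) : Type := {w : List (Fin d × Bool) // w.length ≤ D}

instance (d D : ℕ) : Finite (BoundedWord d D) := List.finite_length_le _ D

/-- The formula expressing that two tuples have the same traces of words of length at most `D`. -/
noncomputable def tracesAgree (D : ℕ) (X Y : Fin d → (matLang L).Term α) :
    (matLang L).Formula α :=
  Formula.iInf fun w : BoundedWord d D =>
    (trTerm (wordTerm X w)).equal (trTerm (wordTerm Y w))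

/-- The formula expressing that two tuples are conjugate under an orthogonal matrix. -/
noncomputable def orthogonallyConjugate (X Y : Fin d → (matLang L).Term α) :
    (matLang L).Formula α :=
  let O : (matLang L).Term (α ⊕ Unit) := .var (.inr ())
  Formula.iExs Unit <| ((O * invTerm O).equal 1) ⊓ Formula.iInf fun i =>
    (invTerm O * (X i).relabel Sum.inl * O).equal ((Y i).relabel Sum.inl)

variable {K : Type*} [Field K] [L.Structure K] (a : α → Matrix (Fin n) (Fin n) K)

theorem realize_tracesAgree [NeZero n] (D : ℕ) (X Y : Fin d → (matLang L).Term α) :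
    (tracesAgree D X Y).Realize a ↔
      TracesAgree (fun i => (X i).realize a) (fun i => (Y i).realize a) D := by
  simp [tracesAgree, TracesAgree, Formula.realize_iInf, Formula.realize_equal]

theorem realize_orthogonallyConjugate (X Y : Fin d → (matLang L).Term α) :
    (orthogonallyConjugate X Y).Realize a ↔
      OrthogonallyConjugate (fun i => (X i).realize a) fun i => (Y i).realize a := by
  rw [orthogonallyConjugate, Formula.realize_iExs, (Equiv.funUnique Unit _).exists_congr_left]
  simp [OrthogonallyConjugate, Formula.realize_iInf, Formula.realize_equal, Function.comp_def]

end Specht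

end matLang

theorem SpechtProperty.of_elementarilyEquivalent {L : FirstOrder.Language.{v, w}} {F : Type u}
    {K : Type x} [Field F] [CompatibleRing F] [L.Structure F] [Field K] [CompatibleRing K]
    [L.Structure K] {n : ℕ} [NeZero n] (hF : SpechtProperty F n) (h : F ≅[fieldLang L] K) :
    SpechtProperty K n := by
  obtain ⟨D, hD⟩ := hF
  have specht_iff := forall_realize_iff_of_elementarilyEquivalent
    (matLang.elementarilyEquivalent_matrix (n := n) h)
    ((matLang.tracesAgree (d := pairDim n) D (Term.var ∘ Sum.inl) (Term.var ∘ Sum.inr)).imp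
      (matLang.orthogonallyConjugate (Term.var ∘ Sum.inl) (Term.var ∘ Sum.inr)))
  simp only [Formula.realize_imp, matLang.realize_tracesAgree,
    matLang.realize_orthogonallyConjugate] at specht_iff
  exact .of_pairDim fun A B => specht_iff.1 (fun a => hD _ _ _) (Sum.elim A B)

/-! ### The Specht property implies quantifier elimination -/

namespace matLang

section Traces

variable {L : FirstOrder.Language.{v, w}} {n d : ℕ} {K : Type*} [Field K] [L.Structure K]

/-- The formula, with a variable for each word of length at most `D`, expressing that some tuple
satisfying `φ` has the given traces of words. -/
noncomputable def hasTraces (D : ℕ) (φ : (matLang L).Formula (Fin d)) :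
    (matLang L).Formula (BoundedWord d D) :=
  Formula.iExs (Fin d) <| φ.relabel Sum.inr ⊓ Formula.iInf fun w : BoundedWord d D =>
    (trTerm (wordTerm (fun i => .var (.inr i)) w.1)).equal (.var (.inl w))

variable [NeZero n]

theorem realize_hasTraces {D : ℕ} (φ : (matLang L).Formula (Fin d))
    (X : Fin d → Matrix (Fin n) (Fin n) K) :
    (hasTraces D φ).Realize (fun w => Matrix.scalar (Fin n) (wordEval X w).trace) ↔
      ∃ Y, φ.Realize Y ∧ TracesAgree Y X D := by
  simp [hasTraces, TracesAgree, Formula.realize_iExs, Formula.realize_iInf, Formula.realize_equal,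
    Formula.realize_relabel, Function.comp_def]

theorem realize_iff_of_conj {ι : Type*} (φ : (matLang L).Formula ι)
    {X Y : ι → Matrix (Fin n) (Fin n) K} (h : OrthogonallyConjugate X Y) :
    φ.Realize X ↔ φ.Realize Y := by
  obtain ⟨O, hO, hXY⟩ := h
  rw [← funext hXY]
  exact (StrongHomClass.realize_formula (conjEquiv (L := L) O hO) φ).symm

end Traces

end matLang

theorem hasQE_of_spechtProperty {L : FirstOrder.Language.{v, w}} {F : Type u} [Field F]
    [CompatibleRing F] [L.Structure F] {n : ℕ} [NeZero n] (hF : HasQE (fieldLang L) F)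
    (h : SpechtProperty F n) : HasQE (matLang L) (Matrix (Fin n) (Fin n) F) := by
  intro k φ
  obtain ⟨D, hD⟩ := h
  obtain ⟨ψ, hψ, hφψ⟩ := matLang.exists_isQF_realize_scalar_iff (n := n) hF
    (matLang.hasTraces D φ)
  refine ⟨ψ.subst fun w => matLang.trTerm (matLang.wordTerm .var w.1), isQF_subst hψ _,
    fun X => ?_⟩
  have realize_subst : Formula.Realize
      (ψ.subst fun w => matLang.trTerm (matLang.wordTerm .var w.1)) X ↔
        ψ.Realize fun w => Matrix.scalar (Fin n) (wordEval X w.1).trace := by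
    refine BoundedFormula.realize_subst.trans ?_
    simp [Formula.Realize]
  rw [realize_subst, ← hφψ, matLang.realize_hasTraces]
  refine ⟨fun hX => ⟨X, hX, fun _ _ => rfl⟩, ?_⟩
  rintro ⟨Y, hY, hYX⟩
  exact (matLang.realize_iff_of_conj φ (hD k Y X hYX)).1 hY

/-! ### The Specht property implies that embeddings extend -/

theorem exists_map_realize_term {L : FirstOrder.Language.{v, w}} {M N ι : Type*} [L.Structure M]
    [L.Structure N] {U : L.Substructure M} (ψ : U ↪[L] N) (t : L.Term ι) (a : ι → U) :
    ∃ h : t.realize (fun i => (a i : M)) ∈ U, ψ ⟨_, h⟩ = t.realize (ψ ∘ a) := by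
  have realize_coe : t.realize (fun i => (a i : M)) = (t.realize a : U) :=
    HomClass.realize_term U.subtype
  refine ⟨realize_coe ▸ (t.realize a).2, ?_⟩
  rw [HomClass.realize_term]
  exact congrArg ψ (Subtype.ext realize_coe)

namespace matLang

section Substructure

variable {L : FirstOrder.Language.{v, w}} {n d : ℕ} [NeZero n] {K : Type*} [Field K]
  [L.Structure K]

theorem nsmul_eq_scalar_trace_iff [CharZero K] (A : Matrix (Fin n) (Fin n) K) :
    n • A = Matrix.scalar (Fin n) A.trace ↔ ∃ a, A = Matrix.scalar (Fin n) a := by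
  have natCast_ne_zero : (n : K) ≠ 0 := Nat.cast_ne_zero.2 (NeZero.ne n)
  constructor
  · intro h
    refine ⟨(n : K)⁻¹ * A.trace, ?_⟩
    rw [map_mul, ← h, Matrix.scalar_apply, ← Matrix.smul_eq_diagonal_mul,
      ← Nat.cast_smul_eq_nsmul K, smul_smul, inv_mul_cancel₀ natCast_ne_zero, one_smul]
  · rintro ⟨a, rfl⟩
    ext i j
    by_cases hij : i = j <;> simp [hij, Matrix.trace]

theorem exists_isQF_realize_iff_exists_scalar [CharZero K] :
    ∃ φ : (matLang L).Formula Unit, BoundedFormula.IsQF φ ∧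
      ∀ A : Unit → Matrix (Fin n) (Fin n) K,
        φ.Realize A ↔ ∃ a, A () = Matrix.scalar (Fin n) a := by
  refine ⟨(List.replicate n (Term.var ())).sum.equal (trTerm (.var ())),
    (BoundedFormula.IsAtomic.equal _ _).isQF, fun A => ?_⟩
  rw [← nsmul_eq_scalar_trace_iff, Formula.realize_equal]
  simp

variable {U : (matLang L).Substructure (Matrix (Fin n) (Fin n) K)}
  (ψ : U ↪[matLang L] Matrix (Fin n) (Fin n) K)

theorem exists_map_eq_scalar [CharZero K] {A : U} {a : K}
    (hA : (A : Matrix (Fin n) (Fin n) K) = Matrix.scalar (Fin n) a) :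
    ∃ b, ψ A = Matrix.scalar (Fin n) b := by
  obtain ⟨φ, hφ, realize_φ⟩ := exists_isQF_realize_iff_exists_scalar (L := L) (n := n) (K := K)
  refine (realize_φ (ψ ∘ fun _ => A)).1 ((realize_comp_embedding_iff ψ hφ _).2 ?_)
  exact (realize_comp_embedding_iff U.subtype hφ _).1 ((realize_φ _).2 ⟨a, hA⟩)

theorem exists_partialElementary [CharZero K] [CompatibleRing K] (hK : HasQE (fieldLang L) K) :
    ∃ ρ : {a : K // Matrix.scalar (Fin n) a ∈ U} → K,
      (∀ a, ψ ⟨Matrix.scalar (Fin n) a.1, a.2⟩ = Matrix.scalar (Fin n) (ρ a)) ∧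
      ∀ φ : (fieldLang L).Formula {a : K // Matrix.scalar (Fin n) a ∈ U},
        φ.Realize Subtype.val → φ.Realize ρ := by
  let c (a : {a : K // Matrix.scalar (Fin n) a ∈ U}) : U := ⟨Matrix.scalar (Fin n) a.1, a.2⟩
  choose ρ hρ using fun a => exists_map_eq_scalar ψ (A := c a) rfl
  refine ⟨ρ, hρ, fun φ => ?_⟩
  obtain ⟨θ, hθ, hφθ⟩ := hK.exists_isQF φ
  have isQF_θ := isQF_onBoundedFormula (ofField (L := L)) hθ
  rw [hφθ, hφθ, ← realize_onFormula_scalar_iff (n := n) hθ,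
    ← realize_onFormula_scalar_iff (n := n) hθ, ← funext hρ]
  exact fun h => (realize_comp_embedding_iff ψ isQF_θ c).2
    ((realize_comp_embedding_iff U.subtype isQF_θ c).1 h)

theorem trace_wordEval_map [CompatibleRing K] {K' : Type*} [Field K'] [CompatibleRing K']
    [L.Structure K'] (j : K ↪ₑ[fieldLang L] K') (X : Fin d → Matrix (Fin n) (Fin n) K)
    (w : List (Fin d × Bool)) :
    (wordEval (fun i => (X i).map j) w).trace = j (wordEval X w).trace := by
  have map_trace := HomClass.realize_term (mapEmbedding (n := n) j)
    (t := trTerm (wordTerm .var w)) (v := X)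
  rw [realize_trTerm, realize_trTerm, realize_wordTerm, realize_wordTerm] at map_trace
  simpa using congrFun (congrFun map_trace 0) 0

end Substructure

end matLang

theorem embeddingsExtend_of_spechtProperty {L : FirstOrder.Language.{v, w}} {F : Type u} [Field F]
    [CompatibleRing F] [IsSemireal F] (hF : IsPythagorean F) [L.Structure F] {n : ℕ} [NeZero n]
    (hQE : HasQE (fieldLang L) F) (h : SpechtProperty F n) :
    EmbeddingsExtend.{u, v, w, x} L F n := by
  intro K _ _ _ hFK U ψ
  have := (hF.of_elementarilyEquivalent hFK).2
  obtain ⟨ρ, hψρ, hρ⟩ := matLang.exists_partialElementary ψ (hQE.of_elementarilyEquivalent hFK)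
  obtain ⟨Ω, S, σ, j, hσj⟩ := exists_elementary_amalgam hρ
  obtain ⟨_, _, _, rfl⟩ := exists_field_of_elementarilyEquivalent j.elementarilyEquivalent
  obtain ⟨D, hD⟩ := h.of_elementarilyEquivalent (hFK.trans j.elementarilyEquivalent)
  have : Nonempty U := ⟨⟨0, U.constants_mem (matLang.ringFun zeroFunc : (matLang L).Constants)⟩⟩
  obtain ⟨e, he⟩ := exists_orthogonallyConjugate_of_comp
    (fun A : U => (A : Matrix (Fin n) (Fin n) K).map σ) fun A : U => (ψ A).map j
  have traces_agree (w : List (Fin (pairDim n) × Bool)) :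
      (wordEval (fun i => (e i : Matrix (Fin n) (Fin n) K).map σ) w).trace =
        (wordEval (fun i => (ψ (e i)).map j) w).trace := by
    obtain ⟨hmem, hψ⟩ := exists_map_realize_term ψ (matLang.trTerm (matLang.wordTerm .var w)) e
    simp only [matLang.realize_trTerm, matLang.realize_wordTerm, Term.realize_var] at hmem hψ
    rw [hψρ ⟨_, hmem⟩, Matrix.scalar_inj] at hψ
    rw [matLang.trace_wordEval_map, matLang.trace_wordEval_map, hσj ⟨_, hmem⟩, hψ]
    rfl
  obtain ⟨O, hO, hconj⟩ := he (hD _ _ _ fun w _ => traces_agree w)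
  exact ⟨Ω, _, _, _, j,
    (matLang.conjEquiv O hO).toEmbedding.comp (matLang.mapEmbedding σ).toEmbedding, hconj⟩

/-! ### The extension of embeddings implies the Specht property -/

namespace matLang

section Embedding

variable {L : FirstOrder.Language.{v, w}} {n d : ℕ} {K K' : Type*} [Field K] [L.Structure K]
  [Field K'] [L.Structure K']

/-- An embedding of matrix structures as a ring homomorphism. -/
noncomputable def ringHomOfEmbedding
    (g : Matrix (Fin n) (Fin n) K ↪[matLang L] Matrix (Fin n) (Fin n) K') :
    Matrix (Fin n) (Fin n) K →+* Matrix (Fin n) (Fin n) K' where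
  toFun := g
  map_one' := g.map_fun (ringFun oneFunc) ![]
  map_mul' A B := g.map_fun (ringFun mulFunc) ![A, B]
  map_zero' := g.map_fun (ringFun zeroFunc) ![]
  map_add' A B := g.map_fun (ringFun addFunc) ![A, B]

variable [NeZero n]

theorem exists_orthogonal_conj_embedding [IsSemireal K'] (hK' : IsPythagorean K')
    (g : Matrix (Fin n) (Fin n) K ↪[matLang L] Matrix (Fin n) (Fin n) K') {j : K → K'}
    (hj : ∀ a, g (Matrix.scalar (Fin n) a) = Matrix.scalar (Fin n) (j a)) :
    ∃ O : Matrix (Fin n) (Fin n) K', O * Oᵀ = 1 ∧ ∀ X, Oᵀ * g X * O = X.map j := by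
  let f := ringHomOfEmbedding g
  have map_transpose (A : Matrix (Fin n) (Fin n) K) : f Aᵀ = (f A)ᵀ := g.map_fun invFun ![A]
  have map_smul (a : K) (A : Matrix (Fin n) (Fin n) K) : f (a • A) = j a • f A := by
    rw [Matrix.smul_eq_diagonal_mul, ← Matrix.scalar_apply, map_mul, Matrix.smul_eq_diagonal_mul,
      ← Matrix.scalar_apply, ← hj]
    rfl
  let E (i : Fin n) : Matrix (Fin n) (Fin n) K := Matrix.single i 0 1
  have isUnitColumn_E : IsUnitColumn 0 E := isUnitColumn_single 0
  have isUnitColumn_map : IsUnitColumn 0 (f ∘ E) :=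
    { transpose_mul := fun i k => by
        simp only [Function.comp_apply, ← map_transpose, ← map_mul,
          isUnitColumn_E.transpose_mul, apply_ite f, map_zero]
      ne_zero := (map_ne_zero_iff f g.injective).2 isUnitColumn_E.ne_zero }
  obtain ⟨O, hO, hconj⟩ := isUnitColumn_map.exists_orthogonal hK'
  refine ⟨O, hO, fun X => hconj _ (f X) fun i => ?_⟩
  simp only [Function.comp_apply, ← map_mul, E, mul_single_column, map_sum, map_smul,
    Matrix.map_apply]

theorem scalar_map [CompatibleRing K] [CompatibleRing K'] (j : K ↪ₑ[fieldLang L] K') (a : K) :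
    (Matrix.scalar (Fin n) a).map j = Matrix.scalar (Fin n) (j a) := by
  have map_zero : mapEmbedding j (0 : Matrix (Fin n) (Fin n) K) = 0 :=
    (mapEmbedding j).map_fun (ringFun zeroFunc) ![]
  exact Matrix.diagonal_map (show j 0 = 0 from congrFun (congrFun map_zero 0) 0)

theorem orthogonallyConjugate_map_iff [CompatibleRing K] [CompatibleRing K']
    (j : K ↪ₑ[fieldLang L] K') {X Y : Fin d → Matrix (Fin n) (Fin n) K} :
    OrthogonallyConjugate (fun i => (X i).map j) (fun i => (Y i).map j) ↔
      OrthogonallyConjugate X Y := by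
  have realize_iff := (mapEmbedding (n := n) j).map_formula
    (orthogonallyConjugate (Term.var ∘ Sum.inl) (Term.var ∘ Sum.inr)) (Sum.elim X Y)
  rwa [realize_orthogonallyConjugate, realize_orthogonallyConjugate] at realize_iff

theorem exists_embedding_of_tracesAgree [IsSemireal K] {X Y : Fin d → Matrix (Fin n) (Fin n) K}
    (h : ∀ D, TracesAgree X Y D) :
    ∃ (U : (matLang L).Substructure (Matrix (Fin n) (Fin n) K))
      (ψ : U ↪[matLang L] Matrix (Fin n) (Fin n) K),
      (∀ a, ∃ ha : Matrix.scalar (Fin n) a ∈ U, ψ ⟨_, ha⟩ = Matrix.scalar (Fin n) a) ∧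
        ∀ i, ∃ hi : X i ∈ U, ψ ⟨X i, hi⟩ = Y i := by
  obtain ⟨U, ψ, hψ⟩ := exists_embedding_of_realize_isQF_iff (L := matLang L)
    (a := Sum.elim (Matrix.scalar (Fin n)) X) (b := Sum.elim (Matrix.scalar (Fin n)) Y)
    fun φ hφ => by
      obtain ⟨D, hD⟩ := exists_realize_iff_of_isQF (K := K) (n := n) (d := d) hφ
      refine hD X Y _ _ _ _ ?_ (h D)
      rintro ((a | i) | i)
      · exact scalar_mem_wordSpan a
      · exact letter_mem_wordSpan i le_rfl
      · exact i.elim0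
  exact ⟨U, ψ, fun a => hψ (.inl a), fun i => hψ (.inr i)⟩

end Embedding

end matLang

section

variable {L : FirstOrder.Language.{v, w}} {F : Type u} [Field F] [CompatibleRing F]
  [L.Structure F] {n : ℕ} [NeZero n]

theorem exists_not_orthogonallyConjugate_of_not_spechtProperty (h : ¬ SpechtProperty F n) :
    ∃ (K : Type (max u x)) (_ : Field K) (_ : CompatibleRing K) (_ : L.Structure K)
      (X Y : Fin (pairDim n) → Matrix (Fin n) (Fin n) K),
      (F ≅[fieldLang L] K) ∧ (∀ D, TracesAgree X Y D) ∧ ¬ OrthogonallyConjugate X Y := by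
  have exists_counterexample (D : ℕ) : ∃ X Y : Fin (pairDim n) → Matrix (Fin n) (Fin n) F,
      TracesAgree X Y D ∧ ¬ OrthogonallyConjugate X Y := by
    by_contra! hD
    exact h (.of_pairDim hD)
  choose X Y hXY hno using exists_counterexample
  obtain ⟨K, S, j, c, hc⟩ := exists_isElementaryLimit (L := fieldLang L) Filter.atTop
    fun D : ULift.{x} ℕ => TupleInterpretation.coords matLang.entries (Sum.elim (X D.1) (Y D.1))
  obtain ⟨_, _, _, rfl⟩ := exists_field_of_elementarilyEquivalent j.elementarilyEquivalent
  obtain ⟨Z, rfl⟩ := TupleInterpretation.exists_coords_eq matLang.entries c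
  have limit := matLang.holds_entryInterpretation.isElementaryLimit
    matLang.holds_entryInterpretation hc
  refine ⟨K, _, _, _, Z ∘ .inl, Z ∘ .inr, j.elementarilyEquivalent, fun D => ?_, ?_⟩
  · refine (matLang.realize_tracesAgree (L := L) Z D (Term.var ∘ Sum.inl) (Term.var ∘ Sum.inr)).1
      (limit.realize ?_)
    filter_upwards [Filter.eventually_ge_atTop ⟨D⟩] with D' hD'
    exact (matLang.realize_tracesAgree ..).2 ((hXY D'.1).mono hD')
  · refine fun hZ => (limit.realize (φ := (matLang.orthogonallyConjugate (Term.var ∘ Sum.inl)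
      (Term.var ∘ Sum.inr)).not) (.of_forall fun D hD => ?_))
      ((matLang.realize_orthogonallyConjugate ..).2 hZ)
    exact hno D.1 ((matLang.realize_orthogonallyConjugate ..).1 hD)

theorem spechtProperty_of_embeddingsExtend [IsSemireal F] (hF : IsPythagorean F)
    (h : EmbeddingsExtend.{u, v, w, x} L F n) : SpechtProperty F n := by
  by_contra hno
  obtain ⟨K, _, _, _, X, Y, hFK, htraces, hXY⟩ :=
    exists_not_orthogonallyConjugate_of_not_spechtProperty.{u, v, w, x} (L := L) hno
  obtain ⟨hK, _⟩ := hF.of_elementarilyEquivalent hFK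
  obtain ⟨U, ψ, hscalar, hψ⟩ := matLang.exists_embedding_of_tracesAgree (L := L) htraces
  obtain ⟨Ω, _, _, _, j, g, hg⟩ := h K hFK U ψ
  obtain ⟨hΩ, _⟩ := hK.of_elementarilyEquivalent j.elementarilyEquivalent
  have g_scalar (a : K) : g (Matrix.scalar (Fin n) a) = Matrix.scalar (Fin n) (j a) := by
    obtain ⟨ha, hψa⟩ := hscalar a
    rw [← matLang.scalar_map, ← congrArg (·.map j) hψa]
    exact hg ⟨_, ha⟩
  have g_X (i : Fin (pairDim n)) : g (X i) = (Y i).map j := by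
    obtain ⟨hi, hψi⟩ := hψ i
    rw [← hψi]
    exact hg ⟨_, hi⟩
  obtain ⟨O, hO, hconj⟩ := matLang.exists_orthogonal_conj_embedding hΩ g g_scalar
  have conj_map : OrthogonallyConjugate (fun i => (Y i).map j) fun i => (X i).map j :=
    ⟨O, hO, fun i => (congrArg (Oᵀ * · * O) (g_X i)).symm.trans (hconj (X i))⟩
  exact hXY ((matLang.orthogonallyConjugate_map_iff j).1 conj_map.symm)

end

theorem mainTheorem1 {F : Type u} [Field F] [CompatibleRing F] [IsSemireal F]
    (hF : IsPythagorean F) (L : FirstOrder.Language.{v, w}) [L.Structure F]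
    (hQE : HasQE (fieldLang L) F) (n : ℕ) (hn : 0 < n) :
    List.TFAE [
      HasQE (matLang L) (Matrix (Fin n) (Fin n) F),
      SpechtProperty F n,
      EmbeddingsExtend.{u, v, w, x} L F n] := by
  have : NeZero n := ⟨hn.ne'⟩
  tfae_have 1 → 2 := spechtProperty_of_hasQE hF
  tfae_have 2 → 1 := hasQE_of_spechtProperty hQE
  tfae_have 2 → 3 := embeddingsExtend_of_spechtProperty hF hQE
  tfae_have 3 → 2 := spechtProperty_of_embeddingsExtend hF
  tfae_finish
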